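/- **Theorem.** Let $d,l,k\ge 1$ be integers with $l\le d$. Consider the following *Probing Game* with objective $\rho\in\mathbb R$. The oracle samples independent uniform $l$-dimensional linear subspaces $V_1,\dots,V_k$ of $\mathbb{R}^d$ (each distributed according to the normalized Haar measure on the Grassmannian of $l$-dimensional subspaces of $\mathbb R^d$). For $i=1,\dots,k$ in turn, the player, based only on $V_1,\dots,V_{i-1}$ (and possibly on private randomness independent of the subspaces), submits a vector $y_i\in\mathbb{R}^d$, and then $V_i$ is revealed to the player. The player wins if for some $i\in\{1,\dots,k\}$ there exists a vector $z\in \mathrm{Span}(y_1,\dots,y_i)$ with $\|z\|=1$ and $$\bigl\|\mathrm{Proj}_{\mathrm{Span}(V_1,\dots,V_i)}(z)\bigr\|\le\rho ,$$ where $\mathrm{Proj}_E$ is the orthogonal projection onto $E$ and $\|\cdot\|$ is the Euclidean norm. There is a universal constant $C_2\ge 8$ such that the following holds. For $\alpha\in(0,1]$ put $C_\alpha=(C_2/\alpha)^{\ln 2/\alpha}$. If $$4kl\le d,\qquad l\ge C_\alpha\ln k,\qquad \rho\le\frac1{12}\sqrt{\frac{l}{d\,k^{\alpha}}},$$ then no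 player wins with probability at least $4d\,e^{-l/16}$; that is, every player wins the Probing Game with probability strictly less than $4d\,e^{-l/16}$. -/

import Mathlib

open MeasureTheory

noncomputable section

/-- The Grassmannian of `l`-dimensional linear subspaces of `ℝ^d`. -/
abbrev Gr (d l : ℕ) : Type :=
  {V : Submodule ℝ (EuclideanSpace ℝ (Fin d)) // Module.finrank ℝ V = l}

/-- The orthogonal projection onto a point of the Grassmannian, as an operator on `ℝ^d`. -/
def Gr.proj {d l : ℕ} (V : Gr d l) :
    EuclideanSpace ℝ (Fin d) →L[ℝ] EuclideanSpace ℝ (Fin d) :=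
  V.1.starProjection

/-- The usual topology of the Grassmannian, that of the gap metric `‖Proj_V - Proj_W‖`. -/
instance Gr.instTopologicalSpace (d l : ℕ) : TopologicalSpace (Gr d l) :=
  TopologicalSpace.induced Gr.proj inferInstance

instance Gr.instMeasurableSpace (d l : ℕ) : MeasurableSpace (Gr d l) := borel _

instance Gr.instBorelSpace (d l : ℕ) : BorelSpace (Gr d l) := ⟨rfl⟩

/-- The orthogonal group `O(d)`: the unitary elements of the algebra of operators on `ℝ^d`
(it is a topological group for the operator norm topology). -/
abbrev OrthGroup (d : ℕ) : Type :=
  unitary (EuclideanSpace ℝ (Fin d) →L[ℝ] EuclideanSpace ℝ (Fin d))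

instance OrthGroup.instContinuousStar (d : ℕ) :
    ContinuousStar (EuclideanSpace ℝ (Fin d) →L[ℝ] EuclideanSpace ℝ (Fin d)) :=
  ⟨ContinuousLinearMap.adjoint.continuous⟩

instance OrthGroup.instCompactSpace (d : ℕ) : CompactSpace (OrthGroup d) := by
  have : ProperSpace (EuclideanSpace ℝ (Fin d) →L[ℝ] EuclideanSpace ℝ (Fin d)) :=
    FiniteDimensional.proper ℝ _
  refine isCompact_iff_compactSpace.mp
    (Metric.isCompact_of_isClosed_isBounded isClosed_unitary ?_)
  refine isBounded_iff_forall_norm_le.mpr ⟨1, fun u hu => ?_⟩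
  refine ContinuousLinearMap.opNorm_le_bound _ zero_le_one fun x => ?_
  rw [one_mul]
  exact ((Unitary.linearIsometryEquiv ⟨u, hu⟩).norm_map x).le

/-- The normalized Haar measure of `O(d)`. -/
def orthHaar (d : ℕ) : Measure (OrthGroup d) :=
  Measure.haarMeasure (⊤ : TopologicalSpace.PositiveCompacts (OrthGroup d))

instance orthHaar.instIsProbabilityMeasure (d : ℕ) : IsProbabilityMeasure (orthHaar d) :=
  ⟨by simpa [orthHaar] using
    Measure.haarMeasure_self (K₀ := (⊤ : TopologicalSpace.PositiveCompacts (OrthGroup d)))⟩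

/-- The action of `O(d)` on the Grassmannian: `U • V` is the image `U(V)`. -/
def OrthGroup.act {d l : ℕ} (U : OrthGroup d) (V : Gr d l) : Gr d l :=
  ⟨V.1.map (Unitary.linearIsometryEquiv U).toLinearEquiv.toLinearMap, by
    rw [LinearEquiv.finrank_map_eq]; exact V.2⟩

theorem OrthGroup.proj_act {d l : ℕ} (U : OrthGroup d) (V : Gr d l) :
    (OrthGroup.act U V).proj = U.1 * V.proj * star U.1 := by
  ext1 x
  have h := Submodule.starProjection_map_apply (Unitary.linearIsometryEquiv U) V.1 x
  exact h

theorem OrthGroup.continuous_act {d l : ℕ} (V : Gr d l) :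
    Continuous fun U : OrthGroup d => OrthGroup.act U V := by
  refine continuous_induced_rng.mpr ?_
  have : Gr.proj ∘ (fun U : OrthGroup d => OrthGroup.act U V) =
      fun U : OrthGroup d => U.1 * V.proj * star U.1 :=
    funext fun U => OrthGroup.proj_act U V
  rw [this]
  exact (continuous_subtype_val.mul continuous_const).mul continuous_subtype_val.star

/-- The coordinate subspace spanned by the first `l` vectors of the standard basis of `ℝ^d`. -/
def coordGr {d l : ℕ} (h : l ≤ d) : Gr d l :=
  ⟨Submodule.span ℝ (Set.range fun i : Fin l =>
      EuclideanSpace.basisFun (Fin d) ℝ (Fin.castLE h i)), by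
    have hli : LinearIndependent ℝ fun i : Fin l =>
        EuclideanSpace.basisFun (Fin d) ℝ (Fin.castLE h i) :=
      (EuclideanSpace.basisFun (Fin d) ℝ).orthonormal.linearIndependent.comp _
        (Fin.castLE_injective h)
    simpa using finrank_span_eq_card hli⟩

/-- The uniform distribution over `l`-dimensional subspaces of `ℝ^d`, that is, the normalized
Haar measure of the Grassmannian: the law of `U(V₀)` for `U` Haar distributed in `O(d)` and a
fixed `l`-dimensional `V₀`. -/
def uniformGr {d l : ℕ} (h : l ≤ d) : Measure (Gr d l) :=
  (orthHaar d).map fun U => OrthGroup.act U (coordGr h)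

instance uniformGr.instIsProbabilityMeasure {d l : ℕ} (h : l ≤ d) :
    IsProbabilityMeasure (uniformGr h) :=
  Measure.isProbabilityMeasure_map (OrthGroup.continuous_act _).measurable.aemeasurable

/-- A (possibly randomized) player of the probing game with `k` rounds. The random seed of the
player lies in `Ω`; the query `y_i` is a measurable function of the seed and of the responses
`V_j`, `j < i`. -/
structure ProbingPlayer (Ω : Type*) [MeasurableSpace Ω] (d l k : ℕ) where
  query : (i : Fin k) → Ω × ({j : Fin k // j < i} → Gr d l) → EuclideanSpace ℝ (Fin d)
  measurable_query : ∀ i, Measurable (query i)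

namespace ProbingPlayer

variable {Ω : Type*} [MeasurableSpace Ω] {d l k : ℕ}

/-- The `i`-th query of the player on the seed `ω`, when the oracle has drawn `V_1, …, V_k`. -/
def y (A : ProbingPlayer Ω d l k) (ω : Ω) (V : Fin k → Gr d l) (i : Fin k) :
    EuclideanSpace ℝ (Fin d) :=
  A.query i (ω, fun j => V j.1)

/-- The player wins on `(ω, V)` with objective `ρ`: for some `i` there is a unit vector `z` in
`Span(y_j, j ≤ i)` whose projection onto `Span(V_j, j ≤ i)` has norm at most `ρ`. -/
def Wins (A : ProbingPlayer Ω d l k) (ρ : ℝ) (ω : Ω) (V : Fin k → Gr d l) : Prop :=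
  ∃ i : Fin k, ∃ z ∈ Submodule.span ℝ {v | ∃ j ≤ i, v = A.y ω V j},
    ‖(⨆ j : {j : Fin k // j ≤ i}, (V j.1).1).starProjection z‖ ≤ ρ ∧ ‖z‖ = 1

/-- The probability that the player wins the probing game, where the seed has law `P` and,
independently of it, `V_1, …, V_k` are independent uniform `l`-dimensional subspaces. -/
def winProb (A : ProbingPlayer Ω d l k) (P : Measure Ω) (h : l ≤ d) (ρ : ℝ) : ℝ :=
  (P.prod (Measure.pi fun _ : Fin k => uniformGr h)).real {x | A.Wins ρ x.1 x.2}

end ProbingPlayer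

/-- The quantity `C_α = (C₂ / α) ^ (ln 2 / α)`. -/
def probingConst (C₂ α : ℝ) : ℝ := (C₂ / α) ^ (Real.log 2 / α)

end

noncomputable section

open ProbabilityTheory

/-! The vector `z` is measured by the sum `projSum` of the squared norms of its projections onto the
single subspaces `V_i`. This sum does not change when `z` is replaced by its projection `w` onto
their span. With high probability it is at most `18 * ‖w‖ ^ 2` for all `w` at once, because `4kl ≤
d`. So it suffices to bound `projSum` from below on the span of the queries of the first `n` rounds,
for every `n ≤ k`.

One random subspace is easy to control on a fixed test space: `d * ‖Proj_V u‖ ^ 2` has moment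
generating function at most that of a chi-square variable (`lintegral_exp_proj_le`). Chernoff bounds
and nets then show that `f` independent subspaces act on a fixed space of dimension at most `f * l /
1000` like a multiple of the identity of order `f * l / d`, up to constant factors
(`measure_distorts_le`). The difficulty is adaptivity: the queries depend on the earlier responses.

The `n` rounds are therefore made to end with `s` stages of lengths `p ^ (s - 1), …, p, 1`. Stage
`a` is tested on the span of the queries known at its start, intersected with a complement that
removes what earlier stages handle. That test space is independent of the responses from stage `a`
on, and has dimension at most `p` times the length of the stage (`finrank_testSpace_le`), which is
affordable once `1000 * p ≤ l`. If no stage fails, then peeling off one stage at a time, by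
projecting orthogonally for the quadratic form of that stage, loses a factor `406` per step
(`norm_sq_le_of_stages`). The total loss is `406 ^ (s - 1) ≤ (p ^ (s - 1)) ^ α ≤ k ^ α` when `p ^ α
≥ 406`, which is the factor `k ^ α` in the objective. A union bound over rounds and stages gives the
probability. For `k = 1` there is no lower bound on `l` beyond `l ≥ 1`, and a direct Chernoff bound
is used. -/

/-! ### Comparison of a random projection with a chi-square variable. -/

theorem lintegral_pi_finset_prod {ι : Type*} [Fintype ι] {X : ι → Type*}
    [∀ i, MeasurableSpace (X i)] (μ : ∀ i, Measure (X i)) [∀ i, IsProbabilityMeasure (μ i)]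
    (s : Finset ι) (f : ∀ i, X i → ENNReal) (hf : ∀ i, Measurable (f i)) :
    ∫⁻ x, ∏ i ∈ s, f i (x i) ∂Measure.pi μ = ∏ i ∈ s, ∫⁻ x, f i x ∂μ i := by
  rw [lintegral_prod_eq_prod_lintegral_of_indepFun s (fun i (x : ∀ i, X i) => f i (x i))
    (iIndepFun_pi fun i => (hf i).aemeasurable) fun i => (hf i).comp (measurable_pi_apply i)]
  refine Finset.prod_congr rfl fun i _ => ?_
  exact (measurePreserving_eval μ i).lintegral_comp (hf i)

theorem lintegral_exp_sq_gaussianReal {s : ℝ} (hs : s < 1 / 2) :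
    ∫⁻ x, ENNReal.ofReal (Real.exp (s * x ^ 2)) ∂gaussianReal 0 1 =
      ENNReal.ofReal (√(1 - 2 * s))⁻¹ := by
  rw [gaussianReal_of_var_ne_zero _ one_ne_zero,
    lintegral_withDensity_eq_lintegral_mul _ (measurable_gaussianPDF _ _) (by fun_prop)]
  have hb : 0 < 1 / 2 - s := by linarith
  have h1 : ∀ x : ℝ, (gaussianPDF 0 1 * fun x : ℝ => ENNReal.ofReal (Real.exp (s * x ^ 2))) x =
      ENNReal.ofReal ((√(2 * Real.pi))⁻¹ * Real.exp (-(1 / 2 - s) * x ^ 2)) := by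
    intro x
    rw [Pi.mul_apply, gaussianPDF_def, ← ENNReal.ofReal_mul (gaussianPDFReal_nonneg _ _ _),
      gaussianPDFReal_def]
    congr 1
    simp only [NNReal.coe_one, mul_one, sub_zero]
    rw [mul_assoc, ← Real.exp_add]
    congr 2
    ring
  simp_rw [h1]
  rw [← ofReal_integral_eq_lintegral_ofReal ((integrable_exp_neg_mul_sq hb).const_mul _)
    (ae_of_all _ fun x => by positivity), integral_const_mul, integral_gaussian]
  congr 1
  rw [← Real.sqrt_inv, ← Real.sqrt_mul (by positivity), ← Real.sqrt_inv]
  congr 1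
  have : 1 - 2 * s ≠ 0 := by linarith
  have := Real.pi_ne_zero
  field_simp

theorem lintegral_exp_sum_sq_stdGaussian {ι : Type*} [Fintype ι] (s : ι → ℝ)
    (hs : ∀ i, s i < 1 / 2) :
    ∫⁻ x : EuclideanSpace ℝ ι, ENNReal.ofReal (Real.exp (∑ i, s i * x i ^ 2)) ∂stdGaussian _ =
      ∏ i, ENNReal.ofReal (√(1 - 2 * s i))⁻¹ := by
  rw [← map_pi_eq_stdGaussian, lintegral_map (by fun_prop) (by fun_prop)]
  simp only [Real.exp_sum]
  simp_rw [ENNReal.ofReal_prod_of_nonneg fun i _ => (Real.exp_pos _).le]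
  rw [lintegral_pi_finset_prod (fun _ : ι => gaussianReal 0 1) Finset.univ
    (fun i x => ENNReal.ofReal (Real.exp (s i * x ^ 2))) (fun i => by fun_prop)]
  exact Finset.prod_congr rfl fun i _ => lintegral_exp_sq_gaussianReal (hs i)

theorem starProjection_coordGr_apply {d l : ℕ} (h : l ≤ d) (x : EuclideanSpace ℝ (Fin d))
    (i : Fin d) :
    (coordGr h).1.starProjection x i = if i.val < l then x i else 0 := by
  have key : (coordGr h).1.starProjection x =
      WithLp.toLp 2 fun i : Fin d => if i.val < l then x i else 0 := by
    apply Submodule.eq_starProjection_of_mem_of_inner_eq_zero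
    · have : (WithLp.toLp 2 fun i : Fin d => if i.val < l then x i else 0) =
          ∑ j : Fin l, x (Fin.castLE h j) • EuclideanSpace.basisFun (Fin d) ℝ (Fin.castLE h j) := by
        ext i
        simp only [EuclideanSpace.basisFun_apply, WithLp.ofLp_sum, WithLp.ofLp_smul,
          Finset.sum_apply, Pi.smul_apply, smul_eq_mul, PiLp.single_apply]
        by_cases hi : i.val < l
        · rw [if_pos hi, Finset.sum_eq_single (⟨i.val, hi⟩ : Fin l)]
          · simp
          · intro b _ hb
            rw [if_neg, mul_zero]
            rintro rfl
            exact hb (Fin.ext rfl)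
          · simp
        · rw [if_neg hi, Finset.sum_eq_zero]
          intro j _
          rw [if_neg, mul_zero]
          rintro rfl
          exact hi j.2
      rw [this]
      exact Submodule.sum_mem _ fun j _ => Submodule.smul_mem _ _ (Submodule.subset_span ⟨j, rfl⟩)
    · intro w hw
      induction hw using Submodule.span_induction with
      | mem w hw =>
        obtain ⟨j, rfl⟩ := hw
        simp [PiLp.inner_apply]
      | zero => simp
      | add a b _ _ ha hb => rw [inner_add_right, ha, hb, add_zero]
      | smul c a _ ha => rw [inner_smul_right, ha, mul_zero]
  rw [key]

theorem norm_sq_starProjection_coordGr {d l : ℕ} (h : l ≤ d) (x : EuclideanSpace ℝ (Fin d)) :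
    ‖(coordGr h).1.starProjection x‖ ^ 2 = ∑ i : Fin d, if i.val < l then x i ^ 2 else 0 := by
  rw [EuclideanSpace.real_norm_sq_eq]
  refine Finset.sum_congr rfl fun i _ => ?_
  rw [starProjection_coordGr_apply]
  split_ifs <;> simp

theorem norm_proj_act {d l : ℕ} (U : OrthGroup d) (V : Gr d l) (x : EuclideanSpace ℝ (Fin d)) :
    ‖(OrthGroup.act U V).1.starProjection x‖ =
      ‖V.1.starProjection ((star U.1 : EuclideanSpace ℝ (Fin d) →L[ℝ] _) x)‖ := by
  have h := congrArg (fun T => T x) (OrthGroup.proj_act U V)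
  change (OrthGroup.act U V).1.starProjection x = _ at h
  rw [h]
  exact Unitary.norm_map U _

theorem measurable_starProjection_act {d l : ℕ} (h : l ≤ d) (lam : ℝ) :
    Measurable fun p : OrthGroup d × EuclideanSpace ℝ (Fin d) =>
      ENNReal.ofReal (Real.exp (lam *
        ‖(coordGr h).1.starProjection ((star p.1.1 : EuclideanSpace ℝ (Fin d) →L[ℝ] _) p.2)‖ ^ 2)) := by
  apply Continuous.measurable
  refine ENNReal.continuous_ofReal.comp (Real.continuous_exp.comp (continuous_const.mul
    (Continuous.pow (Continuous.norm ((coordGr h).1.starProjection.continuous.comp ?_)) 2)))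
  exact (continuous_subtype_val.comp continuous_fst).star.clm_apply continuous_snd

/-- The law of `‖P₀ U⋆ g‖` for Haar distributed `U` depends on `g` through its norm only. -/
theorem lintegral_orthHaar_eq {d l : ℕ} (h : l ≤ d) (lam : ℝ) {e g : EuclideanSpace ℝ (Fin d)}
    (heg : ‖e‖ = ‖g‖) :
    ∫⁻ U : OrthGroup d, ENNReal.ofReal (Real.exp (lam *
        ‖(coordGr h).1.starProjection ((star U.1 : EuclideanSpace ℝ (Fin d) →L[ℝ] _) g)‖ ^ 2))
        ∂orthHaar d =
      ∫⁻ U : OrthGroup d, ENNReal.ofReal (Real.exp (lam *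
        ‖(coordGr h).1.starProjection ((star U.1 : EuclideanSpace ℝ (Fin d) →L[ℝ] _) e)‖ ^ 2))
        ∂orthHaar d := by
  -- Vectors of equal norm are exchanged by a reflection, which left invariance of the Haar measure
  -- absorbs.
  let R : EuclideanSpace ℝ (Fin d) ≃ₗᵢ[ℝ] EuclideanSpace ℝ (Fin d) :=
    (Submodule.span ℝ {e - g})ᗮ.reflection
  have hR : R e = g := Submodule.reflection_sub heg
  let O : OrthGroup d := Unitary.linearIsometryEquiv.symm R
  have hO : O.1 e = g := hR
  have hinv : (orthHaar d).IsMulLeftInvariant := by unfold orthHaar; infer_instance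
  rw [← lintegral_mul_left_eq_self (μ := orthHaar d) _ O]
  refine lintegral_congr fun U => ?_
  have : (star (O * U).1 : EuclideanSpace ℝ (Fin d) →L[ℝ] _) g = (star U.1) e := by
    rw [Submonoid.coe_mul, star_mul, mul_apply_eq_comp, ← hO,
      ← mul_apply_eq_comp (star O.1) O.1, (Unitary.mem_iff.mp O.2).1]
    rfl
  rw [this]

/-- The moment generating function of `d * ‖Proj_V u‖²` for uniform `V` and unit `u` is at most
that of the chi-square distribution with `l` degrees of freedom. -/
theorem lintegral_exp_proj_le {d l : ℕ} (h : l ≤ d) {lam : ℝ} (hlam : lam < 1 / 2)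
    {u : EuclideanSpace ℝ (Fin d)} (hu : ‖u‖ = 1) :
    ∫⁻ V, ENNReal.ofReal (Real.exp (lam * d * ‖V.proj u‖ ^ 2)) ∂uniformGr h ≤
      ENNReal.ofReal (√(1 - 2 * lam))⁻¹ ^ l := by
  have hproj : Measurable fun V : Gr d l => V.proj :=
    (continuous_induced_dom (f := Gr.proj)).measurable
  set F : OrthGroup d → EuclideanSpace ℝ (Fin d) → ℝ := fun U g =>
    ‖(coordGr h).1.starProjection ((star U.1 : EuclideanSpace ℝ (Fin d) →L[ℝ] _) g)‖ ^ 2 with hF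
  have hstarnorm : ∀ (U : OrthGroup d) (x : EuclideanSpace ℝ (Fin d)),
      ‖(star U.1 : EuclideanSpace ℝ (Fin d) →L[ℝ] _) x‖ = ‖x‖ := fun U x =>
    Unitary.norm_map (star U) x
  have hFs : ∀ U (c : ℝ) g, F U (c • g) = c ^ 2 * F U g := by
    intro U c g
    simp only [hF, map_smul, norm_smul, mul_pow, Real.norm_eq_abs, sq_abs]
  have hF0 : ∀ U g, 0 ≤ F U g := fun U g => by positivity
  have hF1 : ∀ U, F U u ≤ 1 := by
    intro U
    have := (coordGr h).1.norm_starProjection_apply_le ((star U.1 : EuclideanSpace ℝ (Fin d) →L[ℝ] _) u)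
    rw [hstarnorm, hu] at this
    have h0 := norm_nonneg ((coordGr h).1.starProjection ((star U.1 : EuclideanSpace ℝ (Fin d) →L[ℝ] _) u))
    simp only [hF]
    nlinarith
  have hmeas : Measurable fun p : OrthGroup d × EuclideanSpace ℝ (Fin d) =>
      ENNReal.ofReal (Real.exp (lam * F p.1 p.2)) := measurable_starProjection_act h lam
  have hact : ∀ U : OrthGroup d, ‖(OrthGroup.act U (coordGr h)).proj u‖ ^ 2 = F U u := by
    intro U
    change ‖(OrthGroup.act U (coordGr h)).1.starProjection u‖ ^ 2 = _
    rw [norm_proj_act]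
  rw [uniformGr, lintegral_map (by
    have := (ContinuousLinearMap.measurable_apply (𝕜 := ℝ) u).comp hproj
    simp only [Function.comp_def] at this
    fun_prop) (OrthGroup.continuous_act _).measurable]
  have e1 : ∫⁻ g : EuclideanSpace ℝ (Fin d), ENNReal.ofReal (Real.exp (lam *
      ‖(coordGr h).1.starProjection g‖ ^ 2)) ∂stdGaussian _ = ENNReal.ofReal (√(1 - 2 * lam))⁻¹ ^ l := by
    have hs : ∀ i : Fin d, (if i.val < l then lam else 0) < 1 / 2 := by
      intro i; split_ifs
      · exact hlam
      · norm_num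
    have := lintegral_exp_sum_sq_stdGaussian (fun i : Fin d => if i.val < l then lam else 0) hs
    simp only [norm_sq_starProjection_coordGr, Finset.mul_sum]
    simp only [ite_mul, zero_mul, mul_ite, mul_zero] at this ⊢
    rw [this]
    have e : ∀ i : Fin d, ENNReal.ofReal (√(1 - if i.val < l then 2 * lam else 0))⁻¹ =
        if i.val < l then ENNReal.ofReal (√(1 - 2 * lam))⁻¹ else 1 := by
      intro i; split_ifs <;> simp
    simp_rw [e]
    rw [Finset.prod_ite, Finset.prod_const_one, mul_one, Finset.prod_const]
    congr 1
    have : (Finset.univ.filter fun i : Fin d => i.val < l) =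
        Finset.univ.map (Fin.castLEEmb h) := by
      ext i
      simp only [Finset.mem_filter, Finset.mem_univ, true_and, Finset.mem_map]
      constructor
      · intro hi; exact ⟨⟨i.val, hi⟩, rfl⟩
      · rintro ⟨j, rfl⟩; exact j.2
    rw [this, Finset.card_map, Finset.card_univ, Fintype.card_fin]
  -- The integral over a Gaussian `g` and a Haar `U` is computed twice. For fixed `U`, rotation
  -- invariance of `g` gives exactly the chi-square value.
  have e2 : ∀ U : OrthGroup d, ∫⁻ g : EuclideanSpace ℝ (Fin d),
      ENNReal.ofReal (Real.exp (lam * F U g)) ∂stdGaussian _ =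
        ENNReal.ofReal (√(1 - 2 * lam))⁻¹ ^ l := by
    intro U
    rw [← e1]
    have := stdGaussian_map (Unitary.linearIsometryEquiv (star U))
    conv_rhs => rw [← this]
    rw [lintegral_map (by fun_prop) (by fun_prop)]
    rfl
  have e3 : ∫⁻ U, ∫⁻ g : EuclideanSpace ℝ (Fin d), ENNReal.ofReal (Real.exp (lam * F U g))
      ∂stdGaussian _ ∂orthHaar d = ENNReal.ofReal (√(1 - 2 * lam))⁻¹ ^ l := by
    simp_rw [e2]
    simp
  rw [lintegral_lintegral_swap hmeas.aemeasurable] at e3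
  -- After the swap, `g` may be replaced by `‖g‖ • u`. A second swap leaves, for fixed `U`, an
  -- explicit Gaussian integral in `‖g‖ ^ 2`, to be bounded below.
  have e4 : ∀ g : EuclideanSpace ℝ (Fin d), ∫⁻ U, ENNReal.ofReal (Real.exp (lam * F U g)) ∂orthHaar d =
      ∫⁻ U, ENNReal.ofReal (Real.exp (lam * F U (‖g‖ • u))) ∂orthHaar d := by
    intro g
    exact lintegral_orthHaar_eq h lam (by rw [norm_smul, hu]; simp)
  clear_value F
  replace e3 := (lintegral_congr e4).symm.trans e3
  rw [lintegral_lintegral_swap (by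
    refine Measurable.aemeasurable ?_
    exact hmeas.comp (measurable_snd.prodMk (measurable_fst.norm.smul_const u)))] at e3
  rw [← e3]
  refine lintegral_mono fun U => ?_
  have hq : lam * F U u < 1 / 2 := by
    rcases le_or_gt lam 0 with h0 | h0
    · nlinarith [hF0 U u]
    · nlinarith [hF1 U]
  have e5 : ∫⁻ g : EuclideanSpace ℝ (Fin d), ENNReal.ofReal (Real.exp (lam * F U (‖g‖ • u)))
      ∂stdGaussian _ = ENNReal.ofReal (√(1 - 2 * (lam * F U u)))⁻¹ ^ d := by
    have := lintegral_exp_sum_sq_stdGaussian (fun _ : Fin d => lam * F U u) fun _ => hq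
    simp only [Finset.prod_const, Finset.card_univ, Fintype.card_fin] at this
    rw [← this]
    refine lintegral_congr fun g => ?_
    rw [hFs, EuclideanSpace.real_norm_sq_eq, ← Finset.mul_sum]
    congr 2
    ring
  rw [hact U]
  rw [e5, ← ENNReal.ofReal_pow (by positivity)]
  apply ENNReal.ofReal_le_ofReal
  -- This is `1 - 2x ≤ exp (-2x)`, valid for either sign of `lam`.
  have h6 : Real.exp (lam * F U u) ≤ (√(1 - 2 * (lam * F U u)))⁻¹ := by
    rw [← inv_inv (Real.exp _), ← Real.exp_neg]
    apply inv_anti₀ (Real.sqrt_pos.mpr (by linarith))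
    rw [Real.sqrt_le_left (Real.exp_pos _).le, ← Real.exp_nat_mul]
    have := Real.add_one_le_exp ((2 : ℕ) * -(lam * F U u))
    push_cast at this ⊢
    linarith
  calc Real.exp (lam * d * F U u) = Real.exp (lam * F U u) ^ d := by
        rw [← Real.exp_nat_mul]; congr 1; ring
    _ ≤ _ := by gcongr

/-! ### Nets of the unit ball and quadratic forms. -/

section Nets

variable {G : Type*} [NormedAddCommGroup G] [NormedSpace ℝ G]

/-- A `1`-separated subset of the ball of radius `2` has at most `5 ^ dim` points; one of maximal
cardinality is a `1`-net of that ball, and halving it gives the net. -/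
theorem exists_finset_half_net (G : Type*) [NormedAddCommGroup G] [NormedSpace ℝ G]
    [FiniteDimensional ℝ G] :
    ∃ N : Finset G, N.card ≤ 5 ^ Module.finrank ℝ G ∧ (∀ x ∈ N, ‖x‖ ≤ 1) ∧
      ∀ u : G, ‖u‖ ≤ 1 → ∃ x ∈ N, ‖u - x‖ ≤ 1 / 2 := by
  classical
  let good : Finset G → Prop := fun s => (∀ c ∈ s, ‖c‖ ≤ 2) ∧
    ∀ c ∈ s, ∀ d ∈ s, c ≠ d → 1 ≤ ‖c - d‖
  have hbd : ∀ s, good s → s.card ≤ 5 ^ Module.finrank ℝ G := fun s hs =>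
    Besicovitch.card_le_of_separated s hs.1 hs.2
  let Pn : ℕ → Prop := fun n => ∃ s, good s ∧ s.card = n
  have h0 : Pn 0 := ⟨∅, by simp [good], rfl⟩
  obtain ⟨s, hs, hcard⟩ : Pn (Nat.findGreatest Pn (5 ^ Module.finrank ℝ G)) :=
    Nat.findGreatest_spec (Nat.zero_le _) h0
  have hmax : ∀ t, good t → t.card ≤ s.card := fun t ht => by
    rw [hcard]; exact Nat.le_findGreatest (hbd t ht) ⟨t, ht, rfl⟩
  refine ⟨s.image fun x => (1 / 2 : ℝ) • x, Finset.card_image_le.trans (hbd s hs), ?_, ?_⟩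
  · intro x hx
    obtain ⟨y, hy, rfl⟩ := Finset.mem_image.mp hx
    rw [norm_smul]
    have := hs.1 y hy
    norm_num
    linarith
  · intro u hu
    by_contra! hcon
    have hfar : ∀ y ∈ s, 1 < ‖(2 : ℝ) • u - y‖ := by
      intro y hy
      have h1 := hcon _ (Finset.mem_image_of_mem _ hy)
      have h2 : (2 : ℝ) • u - y = (2 : ℝ) • (u - (1 / 2 : ℝ) • y) := by
        rw [smul_sub, smul_smul]; norm_num
      rw [h2, norm_smul]
      norm_num at h1 ⊢
      linarith
    have hnot : (2 : ℝ) • u ∉ s := fun hmem => by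
      have := hfar _ hmem
      rw [sub_self, norm_zero] at this
      linarith
    have hg : good (insert ((2 : ℝ) • u) s) := by
      refine ⟨?_, ?_⟩
      · intro c hc
        rcases Finset.mem_insert.mp hc with rfl | hc
        · rw [norm_smul]; norm_num; linarith
        · exact hs.1 c hc
      · intro c hc c' hc' hne
        rcases Finset.mem_insert.mp hc with rfl | hc <;>
          rcases Finset.mem_insert.mp hc' with rfl | hc'
        · exact absurd rfl hne
        · exact (hfar _ hc').le
        · rw [norm_sub_rev]; exact (hfar _ hc).le
        · exact hs.2 c hc c' hc' hne
    have := hmax _ hg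
    rw [Finset.card_insert_of_notMem hnot] at this
    omega

/-- Each refinement approximates the rescaled remainder by the `1/2`-net, halving the error at the
cost of a factor `5 ^ dim`. -/
theorem exists_finset_net (G : Type*) [NormedAddCommGroup G] [NormedSpace ℝ G]
    [FiniteDimensional ℝ G] (m : ℕ) :
    ∃ N : Finset G, N.card ≤ (5 ^ Module.finrank ℝ G) ^ m ∧
      ∀ u : G, ‖u‖ ≤ 1 → ∃ x ∈ N, ‖u - x‖ ≤ (1 / 2) ^ m := by
  classical
  obtain ⟨H, hHcard, -, hH⟩ := exists_finset_half_net G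
  induction m with
  | zero => exact ⟨{0}, by simp, fun u hu => ⟨0, by simp, by simpa using hu⟩⟩
  | succ m ih =>
    obtain ⟨N, hNcard, hN⟩ := ih
    refine ⟨(N ×ˢ H).image fun p => p.1 + ((1 / 2 : ℝ) ^ m) • p.2, ?_, ?_⟩
    · refine Finset.card_image_le.trans ?_
      rw [Finset.card_product, pow_succ]
      exact Nat.mul_le_mul hNcard hHcard
    · intro u hu
      obtain ⟨x, hx, hxu⟩ := hN u hu
      have hpos : (0 : ℝ) < (1 / 2) ^ m := by positivity
      obtain ⟨c, hc, hcu⟩ := hH (((1 / 2 : ℝ) ^ m)⁻¹ • (u - x)) (by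
        rw [norm_smul, Real.norm_of_nonneg (by positivity)]
        rw [inv_mul_le_iff₀ hpos]; simpa using hxu)
      refine ⟨_, Finset.mem_image_of_mem _ (Finset.mk_mem_product hx hc), ?_⟩
      have : u - (x + (1 / 2 : ℝ) ^ m • c) =
          (1 / 2 : ℝ) ^ m • (((1 / 2 : ℝ) ^ m)⁻¹ • (u - x) - c) := by
        rw [smul_sub, smul_smul, mul_inv_cancel₀ hpos.ne', one_smul]; abel
      rw [this, norm_smul, Real.norm_of_nonneg hpos.le, pow_succ]
      gcongr

/-- A bound of a quadratic form on a `1/2`-net of the unit ball extends to the whole space. -/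
theorem quadratic_le_of_half_net [FiniteDimensional ℝ G] {q : G → ℝ} (hq : Continuous q)
    (hadd : ∀ x y, q (x + y) ≤ 2 * q x + 2 * q y) (hsmul : ∀ (c : ℝ) x, q (c • x) = c ^ 2 * q x)
    {N : Finset G} (hN1 : ∀ x ∈ N, ‖x‖ ≤ 1) (hN : ∀ u : G, ‖u‖ ≤ 1 → ∃ x ∈ N, ‖u - x‖ ≤ 1 / 2)
    {τ : ℝ} (hτ : 0 ≤ τ) (hNq : ∀ x ∈ N, q x ≤ τ * ‖x‖ ^ 2) (u : G) : q u ≤ 4 * τ * ‖u‖ ^ 2 := by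
  have : ProperSpace G := FiniteDimensional.proper ℝ G
  obtain ⟨u₀, hu₀, hmax⟩ := (isCompact_closedBall (0 : G) 1).exists_isMaxOn
    ⟨0, by simp⟩ hq.continuousOn
  have hmax' : ∀ v : G, ‖v‖ ≤ 1 → q v ≤ q u₀ := fun v hv => hmax (by simpa using hv)
  -- At a maximizer, `q u₀ ≤ 2 * q x + 2 * q (u₀ - x) ≤ 2 * τ + q u₀ / 2`, since `u₀ - x` has norm
  -- at most `1 / 2`.
  have hb : q u₀ ≤ 4 * τ := by
    obtain ⟨x, hx, hxu⟩ := hN u₀ (by simpa using hu₀)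
    have h1 := hadd x (u₀ - x)
    rw [add_sub_cancel] at h1
    have h2 := hmax' ((2 : ℝ) • (u₀ - x)) (by rw [norm_smul]; norm_num; linarith)
    rw [hsmul] at h2
    have h3 := hNq x hx
    have h4 := hN1 x hx
    have h5 : ‖x‖ ^ 2 ≤ 1 := pow_le_one₀ (norm_nonneg _) h4
    nlinarith
  rcases eq_or_ne u 0 with rfl | hu
  · have := hsmul 0 0
    simp at this
    simp [this]
  · have hpos : 0 < ‖u‖ := norm_pos_iff.mpr hu
    have h1 := hmax' (‖u‖⁻¹ • u) (by rw [norm_smul]; simp [hpos.ne'])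
    rw [hsmul] at h1
    have h2 : q u = ‖u‖ ^ 2 * (‖u‖⁻¹ ^ 2 * q u) := by
      field_simp
    rw [h2]
    nlinarith [sq_nonneg ‖u‖]

/-- A lower bound of a quadratic form on a fine net of the unit ball extends to the whole space. -/
theorem le_quadratic_of_net {q : G → ℝ}
    (hadd : ∀ x y, q (x + y) ≤ 2 * q x + 2 * q y) (hsmul : ∀ (c : ℝ) x, q (c • x) = c ^ 2 * q x)
    {N : Finset G} (hN : ∀ u : G, ‖u‖ ≤ 1 → ∃ x ∈ N, ‖u - x‖ ≤ (1 / 2) ^ 6)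
    {τ : ℝ} (hτ : 0 ≤ τ) (hup : ∀ u, q u ≤ 16 * τ * ‖u‖ ^ 2)
    (hNq : ∀ x ∈ N, 3 / 8 * τ * ‖x‖ ^ 2 ≤ q x) (u : G) : 4 / 25 * τ * ‖u‖ ^ 2 ≤ q u := by
  rcases eq_or_ne u 0 with rfl | hu
  · have := hsmul 0 0
    simp at this
    simp [this]
  have hpos : 0 < ‖u‖ := norm_pos_iff.mpr hu
  set v := ‖u‖⁻¹ • u with hv
  have hv1 : ‖v‖ = 1 := by rw [hv, norm_smul]; simp [hpos.ne']
  -- From `q x ≤ 2 * q v + 2 * q (x - v)`: the upper bound makes the error `q (x - v)` at most `16 *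
  -- τ / 64 ^ 2`, and `(3 / 8) * (63 / 64) ^ 2 / 2 - 1 / 256` exceeds `4 / 25`.
  have hkey : 4 / 25 * τ ≤ q v := by
    obtain ⟨x, hx, hxv⟩ := hN v hv1.le
    have h1 := hadd v (x - v)
    rw [add_sub_cancel] at h1
    have h2 := hup (x - v)
    rw [norm_sub_rev] at hxv
    have h3 : ‖x - v‖ ^ 2 ≤ ((1 / 2) ^ 6) ^ 2 := by gcongr
    have h4 : 63 / 64 ≤ ‖x‖ := by
      have := norm_sub_norm_le v x
      rw [norm_sub_rev] at this
      norm_num at hxv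
      linarith
    have h5 := hNq x hx
    have h6 : (63 / 64) ^ 2 ≤ ‖x‖ ^ 2 := by gcongr
    have h7 := mul_le_mul_of_nonneg_left h3 hτ
    have h8 := mul_le_mul_of_nonneg_left h6 hτ
    norm_num at h7 h8
    linarith
  have h2 : u = ‖u‖ • v := by rw [hv, smul_smul, mul_inv_cancel₀ hpos.ne', one_smul]
  have h3 : q u = ‖u‖ ^ 2 * q v := by
    conv_lhs => rw [h2]
    rw [hsmul]
  rw [h3]
  nlinarith [sq_nonneg ‖u‖]

end Nets

/-! ### Chernoff bounds, for one vector and then uniformly on a fixed subspace. -/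

section Tails

variable {d l k : ℕ}

/-- The sum of the squared norms of the projections of `x` onto the subspaces with index in `I`. -/
def projSum (I : Finset (Fin k)) (V : Fin k → Gr d l) (x : EuclideanSpace ℝ (Fin d)) : ℝ :=
  ∑ i ∈ I, ‖(V i).proj x‖ ^ 2

theorem projSum_nonneg (I : Finset (Fin k)) (V : Fin k → Gr d l) (x) : 0 ≤ projSum I V x :=
  Finset.sum_nonneg fun _ _ => by positivity

theorem projSum_mono {I J : Finset (Fin k)} (h : I ⊆ J) (V : Fin k → Gr d l) (x) :
    projSum I V x ≤ projSum J V x :=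
  Finset.sum_le_sum_of_subset_of_nonneg h fun _ _ _ => by positivity

theorem projSum_smul (I : Finset (Fin k)) (V : Fin k → Gr d l) (c : ℝ) (x) :
    projSum I V (c • x) = c ^ 2 * projSum I V x := by
  simp [projSum, norm_smul, mul_pow, Finset.mul_sum]

theorem projSum_add_le (I : Finset (Fin k)) (V : Fin k → Gr d l) (x y) :
    projSum I V (x + y) ≤ 2 * projSum I V x + 2 * projSum I V y := by
  simp only [projSum, Finset.mul_sum, ← Finset.sum_add_distrib]
  refine Finset.sum_le_sum fun i _ => ?_
  rw [map_add]
  have h := parallelogram_law_with_norm ℝ ((V i).proj x) ((V i).proj y)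
  nlinarith [mul_self_nonneg ‖(V i).proj x - (V i).proj y‖]

theorem continuous_projSum (I : Finset (Fin k)) (V : Fin k → Gr d l) :
    Continuous (projSum I V) := by
  unfold projSum
  fun_prop

theorem Gr.measurable_proj : Measurable (Gr.proj (d := d) (l := l)) :=
  (continuous_induced_dom (f := Gr.proj)).measurable

theorem Gr.measurable_proj_apply (x : EuclideanSpace ℝ (Fin d)) :
    Measurable fun V : Gr d l => V.proj x :=
  Gr.measurable_proj.apply_continuousLinearMap x

theorem measurable_projSum (I : Finset (Fin k)) (x : EuclideanSpace ℝ (Fin d)) :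
    Measurable fun V : Fin k → Gr d l => projSum I V x := by
  unfold projSum
  exact Finset.measurable_sum _ fun i _ =>
    (((Gr.measurable_proj_apply x).comp (measurable_pi_apply i)).norm.pow_const 2)

variable (k) in
/-- The law of `k` independent uniform `l`-dimensional subspaces. -/
abbrev uniformGrPi (h : l ≤ d) : Measure (Fin k → Gr d l) :=
  Measure.pi fun _ : Fin k => uniformGr h

theorem lintegral_exp_projSum_le (h : l ≤ d) (I : Finset (Fin k)) {lam : ℝ} (hlam : lam < 1 / 2)
    {u : EuclideanSpace ℝ (Fin d)} (hu : ‖u‖ = 1) :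
    ∫⁻ V, ENNReal.ofReal (Real.exp (lam * (d * projSum I V u))) ∂uniformGrPi k h ≤
      ENNReal.ofReal ((√(1 - 2 * lam))⁻¹ ^ (l * I.card)) := by
  have e : ∀ V : Fin k → Gr d l, ENNReal.ofReal (Real.exp (lam * (d * projSum I V u))) =
      ∏ i ∈ I, ENNReal.ofReal (Real.exp (lam * d * ‖(V i).proj u‖ ^ 2)) := by
    intro V
    rw [projSum, ← mul_assoc, Finset.mul_sum, Real.exp_sum,
      ENNReal.ofReal_prod_of_nonneg fun i _ => (Real.exp_pos _).le]
  simp_rw [e]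
  rw [lintegral_pi_finset_prod (fun _ : Fin k => uniformGr h) I
    (fun _ V => ENNReal.ofReal (Real.exp (lam * d * ‖V.proj u‖ ^ 2))) (fun i => by
      have := Gr.measurable_proj_apply (l := l) u
      fun_prop)]
  calc _ ≤ ∏ _i ∈ I, ENNReal.ofReal (√(1 - 2 * lam))⁻¹ ^ l :=
        Finset.prod_le_prod' fun i _ => lintegral_exp_proj_le h hlam hu
    _ = _ := by
        rw [Finset.prod_const, ← pow_mul, ENNReal.ofReal_pow (by positivity)]

/-- Markov's inequality for the exponential moment. Keeping `lam` on both sides of the event treats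
the upper tail (`lam > 0`) and the lower tail (`lam < 0`) together. -/
theorem measure_projSum_tail_le (h : l ≤ d) (I : Finset (Fin k)) {lam : ℝ} (hlam : lam < 1 / 2)
    (τ : ℝ) (x : EuclideanSpace ℝ (Fin d)) :
    uniformGrPi k h {V | lam * (τ * ‖x‖ ^ 2) < lam * (d * projSum I V x)} ≤
      ENNReal.ofReal ((√(1 - 2 * lam))⁻¹ ^ (l * I.card) * Real.exp (-(lam * τ))) := by
  rcases eq_or_ne x 0 with rfl | hx
  · simp [projSum]
  have hpos : 0 < ‖x‖ := norm_pos_iff.mpr hx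
  set u := ‖x‖⁻¹ • x with hu
  have hu1 : ‖u‖ = 1 := by rw [hu, norm_smul]; simp [hpos.ne']
  have hsub : {V : Fin k → Gr d l | lam * (τ * ‖x‖ ^ 2) < lam * (d * projSum I V x)} ⊆
      {V | ENNReal.ofReal (Real.exp (lam * τ)) ≤
        ENNReal.ofReal (Real.exp (lam * (d * projSum I V u)))} := by
    intro V hV
    simp only [Set.mem_ofPred_eq] at hV ⊢
    apply ENNReal.ofReal_le_ofReal
    apply Real.exp_le_exp.mpr
    rw [hu, projSum_smul]
    have : lam * (d * (‖x‖⁻¹ ^ 2 * projSum I V x)) - lam * τ =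
        ‖x‖⁻¹ ^ 2 * (lam * (d * projSum I V x) - lam * (τ * ‖x‖ ^ 2)) := by
      field_simp
    have h2 : 0 ≤ ‖x‖⁻¹ ^ 2 * (lam * (d * projSum I V x) - lam * (τ * ‖x‖ ^ 2)) :=
      mul_nonneg (by positivity) (by linarith)
    linarith
  refine (measure_mono hsub).trans ?_
  have hm := measurable_projSum (d := d) (l := l) I u
  have hmk := meas_ge_le_lintegral_div (μ := uniformGrPi k h)
    (f := fun V => ENNReal.ofReal (Real.exp (lam * (d * projSum I V u)))) (by fun_prop)
    (ε := ENNReal.ofReal (Real.exp (lam * τ)))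
    (by rw [Ne, ENNReal.ofReal_eq_zero, not_le]; exact Real.exp_pos _) ENNReal.ofReal_ne_top
  refine hmk.trans ?_
  rw [Real.exp_neg, ENNReal.ofReal_mul (by positivity),
    ENNReal.ofReal_inv_of_pos (Real.exp_pos _), ← div_eq_mul_inv]
  exact ENNReal.div_le_div_right (lintegral_exp_projSum_le h I hlam hu1) _

theorem measure_finset_exists_le {X ι : Type*} [MeasurableSpace X] (μ : Measure X) (N : Finset ι)
    (S : ι → Set X) {n : ℕ} (hn : N.card ≤ n) {ε : ℝ}
    (h : ∀ x ∈ N, μ (S x) ≤ ENNReal.ofReal ε) :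
    μ {V | ∃ x ∈ N, V ∈ S x} ≤ ENNReal.ofReal (n * ε) := by
  have : {V | ∃ x ∈ N, V ∈ S x} = ⋃ x ∈ N, S x := by ext; simp
  rw [this]
  calc μ (⋃ x ∈ N, S x) ≤ ∑ x ∈ N, μ (S x) := measure_biUnion_finset_le _ _
    _ ≤ ∑ _x ∈ N, ENNReal.ofReal ε := Finset.sum_le_sum h
    _ = N.card * ENNReal.ofReal ε := by rw [Finset.sum_const, nsmul_eq_mul]
    _ ≤ n * ENNReal.ofReal ε := by gcongr
    _ = _ := by rw [ENNReal.ofReal_mul (by positivity), ENNReal.ofReal_natCast]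

theorem measure_exists_projSum_gt (h : l ≤ d) (T : Finset (Fin k))
    (U : Submodule ℝ (EuclideanSpace ℝ (Fin d))) {n : ℕ} (hn : Module.finrank ℝ U ≤ n)
    {lam : ℝ} (hlam : lam < 1 / 2) (hlam0 : 0 < lam) {τ : ℝ} (hτ : 0 ≤ τ) :
    uniformGrPi k h {V | ∃ u ∈ U, 4 * τ * ‖u‖ ^ 2 < d * projSum T V u} ≤
      ENNReal.ofReal (5 ^ n * ((√(1 - 2 * lam))⁻¹ ^ (l * T.card) * Real.exp (-(lam * τ)))) := by
  obtain ⟨N, hNcard, hN1, hN⟩ := exists_finset_half_net U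
  have hsub : {V : Fin k → Gr d l | ∃ u ∈ U, 4 * τ * ‖u‖ ^ 2 < d * projSum T V u} ⊆
      {V | ∃ x ∈ N, V ∈ {V : Fin k → Gr d l |
        lam * (τ * ‖(x : EuclideanSpace ℝ (Fin d))‖ ^ 2) < lam * (d * projSum T V x)}} := by
    rintro V ⟨u, hu, hlt⟩
    by_contra hcon
    simp only [Set.mem_ofPred_eq, not_exists, not_and, not_lt] at hcon
    have := quadratic_le_of_half_net (G := U) (q := fun x => d * projSum T V x)
      (continuous_const.mul ((continuous_projSum T V).comp continuous_subtype_val))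
      (fun x y => by
        have := projSum_add_le T V x y
        have hd : (0 : ℝ) ≤ d := by positivity
        rw [Submodule.coe_add]
        nlinarith)
      (fun c x => by rw [Submodule.coe_smul, projSum_smul]; ring) hN1 hN hτ
      (fun x hx => le_of_mul_le_mul_left (hcon x hx) hlam0) ⟨u, hu⟩
    simp only [Submodule.coe_norm] at this
    linarith
  refine (measure_mono hsub).trans ?_
  have h5 : N.card ≤ 5 ^ n := hNcard.trans (Nat.pow_le_pow_right (by norm_num) hn)
  refine (measure_finset_exists_le _ N _ h5
    fun x _ => measure_projSum_tail_le h T hlam τ x).trans_eq ?_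
  push_cast
  rfl

/-- The upper bound inside the event is what allows a lower bound on a net to be extended to all of
`U`. The tail bound is used with `lam = -1`, hence `√3`. -/
theorem measure_exists_projSum_lt (h : l ≤ d) (I : Finset (Fin k))
    (U : Submodule ℝ (EuclideanSpace ℝ (Fin d))) {n : ℕ} (hn : Module.finrank ℝ U ≤ n)
    {τ : ℝ} (hτ : 0 ≤ τ) :
    uniformGrPi k h {V | (∃ u ∈ U, d * projSum I V u < 4 / 25 * τ * ‖u‖ ^ 2) ∧
        ∀ u ∈ U, d * projSum I V u ≤ 16 * τ * ‖u‖ ^ 2} ≤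
      ENNReal.ofReal (5 ^ (n * 6) * ((√3)⁻¹ ^ (l * I.card) * Real.exp (3 / 8 * τ))) := by
  obtain ⟨N, hNcard, hN⟩ := exists_finset_net U 6
  have hsub : {V : Fin k → Gr d l | (∃ u ∈ U, d * projSum I V u < 4 / 25 * τ * ‖u‖ ^ 2) ∧
        ∀ u ∈ U, d * projSum I V u ≤ 16 * τ * ‖u‖ ^ 2} ⊆
      {V | ∃ x ∈ N, V ∈ {V : Fin k → Gr d l |
        (-1 : ℝ) * (3 / 8 * τ * ‖(x : EuclideanSpace ℝ (Fin d))‖ ^ 2) <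
          (-1) * (d * projSum I V x)}} := by
    rintro V ⟨⟨u, hu, hlt⟩, hup⟩
    by_contra hcon
    simp only [Set.mem_ofPred_eq, not_exists, not_and, not_lt] at hcon
    have := le_quadratic_of_net (G := U) (q := fun x => d * projSum I V x)
      (fun x y => by
        have := projSum_add_le I V x y
        have hd : (0 : ℝ) ≤ d := by positivity
        rw [Submodule.coe_add]
        nlinarith)
      (fun c x => by rw [Submodule.coe_smul, projSum_smul]; ring) hN hτ
      (fun x => hup x x.2)
      (fun x hx => by have := hcon x hx; rw [Submodule.coe_norm]; linarith) ⟨u, hu⟩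
    simp only [Submodule.coe_norm] at this
    linarith
  refine (measure_mono hsub).trans ?_
  have h5 : N.card ≤ 5 ^ (n * 6) := by
    rw [pow_mul]
    exact hNcard.trans (Nat.pow_le_pow_left (Nat.pow_le_pow_right (by norm_num) hn) _)
  refine (measure_finset_exists_le _ N _ h5
    fun x _ => measure_projSum_tail_le h I (by norm_num : (-1 : ℝ) < 1 / 2) (3 / 8 * τ) x).trans_eq ?_
  push_cast
  norm_num

end Tails

/-! ### Failure probabilities with explicit constants. -/

section StageBound

variable {d l k : ℕ}

theorem five_le_exp : (5 : ℝ) ≤ Real.exp (81 / 50) := by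
  rw [← Real.log_le_iff_le_exp (by norm_num)]
  have h1 : Real.log ((5 : ℝ) ^ 3) ≤ Real.log ((2 : ℝ) ^ 7) :=
    Real.log_le_log (by norm_num) (by norm_num)
  rw [Real.log_pow, Real.log_pow] at h1
  have := Real.log_two_lt_d9
  push_cast at h1
  linarith

theorem inv_sqrt_half_le_exp : (√(1 - 2 * (1 / 4 : ℝ)))⁻¹ ≤ Real.exp (7 / 20) := by
  rw [← Real.sqrt_inv, Real.sqrt_le_left (Real.exp_pos _).le, ← Real.exp_nat_mul,
    ← Real.log_le_iff_le_exp (by norm_num)]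
  have := Real.log_two_lt_d9
  norm_num
  linarith

theorem inv_sqrt_eighth_le_exp : (√(1 - 2 * (7 / 16 : ℝ)))⁻¹ ≤ Real.exp (26 / 25) := by
  rw [← Real.sqrt_inv, Real.sqrt_le_left (Real.exp_pos _).le, ← Real.exp_nat_mul,
    ← Real.log_le_iff_le_exp (by norm_num)]
  have := Real.log_two_lt_d9
  have h1 : Real.log 8 = 3 * Real.log 2 := by
    rw [show (8 : ℝ) = 2 ^ 3 by norm_num, Real.log_pow]; norm_num
  norm_num
  linarith

theorem inv_sqrt_three_le_exp : (√3 : ℝ)⁻¹ ≤ Real.exp (-(1 / 2)) := by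
  rw [← Real.sqrt_inv, Real.sqrt_le_left (Real.exp_pos _).le, ← Real.exp_nat_mul,
    ← Real.log_le_iff_le_exp (by norm_num), Real.log_inv]
  have h1 : Real.log ((2 : ℝ) ^ 3) ≤ Real.log ((3 : ℝ) ^ 2) :=
    Real.log_le_log (by norm_num) (by norm_num)
  rw [Real.log_pow, Real.log_pow] at h1
  have := Real.log_two_gt_d9
  push_cast at h1
  norm_num
  linarith

/-- The family of subspaces `V` distorts `U`: the projections with index in `T` are too large,
or those with index in `I` too small, on some vector of `U`. The normalization is `f * l / d`. -/
def Distorts (f : ℕ) (I T : Finset (Fin k)) (V : Fin k → Gr d l)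
    (U : Submodule ℝ (EuclideanSpace ℝ (Fin d))) : Prop :=
  ∃ u ∈ U, 16 * (f * l : ℝ) * ‖u‖ ^ 2 < d * projSum T V u ∨
    d * projSum I V u < 4 / 25 * (f * l : ℝ) * ‖u‖ ^ 2

/-- Either the upper bound fails on `T`, or it holds on `T`, hence on `I`, and the lower bound fails
on `I`. Each event costs one net, whose cardinality is negligible because the dimension is at most
`f * l / 1000`. -/
theorem measure_distorts_le (h : l ≤ d) {I T : Finset (Fin k)} (hIT : I ⊆ T) {f : ℕ} (hf : 1 ≤ f)
    (hI : I.card = f) (hT : T.card ≤ 2 * f) (U : Submodule ℝ (EuclideanSpace ℝ (Fin d))) {n : ℕ}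
    (hn : Module.finrank ℝ U ≤ n) (hnl : 1000 * n ≤ f * l) :
    uniformGrPi k h {V | Distorts f I T V U} ≤ ENNReal.ofReal (2 * Real.exp (-(l : ℝ) / 16)) := by
  set m : ℝ := (f * l : ℝ) with hm
  have hm0 : 0 ≤ m := by positivity
  have hml : (l : ℝ) ≤ m := by
    have : (1 : ℝ) ≤ f := by exact_mod_cast hf
    have : (0 : ℝ) ≤ l := by positivity
    nlinarith
  have hnm : 1000 * (n : ℝ) ≤ m := by rw [hm]; exact_mod_cast hnl
  have hsub : {V : Fin k → Gr d l | Distorts f I T V U} ⊆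
      {V | ∃ u ∈ U, 4 * (4 * m) * ‖u‖ ^ 2 < d * projSum T V u} ∪
      {V | (∃ u ∈ U, d * projSum I V u < 4 / 25 * m * ‖u‖ ^ 2) ∧
        ∀ u ∈ U, d * projSum I V u ≤ 16 * m * ‖u‖ ^ 2} := by
    intro V hV
    by_cases hup : ∃ u ∈ U, 4 * (4 * m) * ‖u‖ ^ 2 < d * projSum T V u
    · exact Or.inl hup
    · have hup' := hup
      push Not at hup
      refine Or.inr ⟨?_, fun u hu => ?_⟩
      · obtain ⟨u, hu, h1 | h1⟩ := hV
        · exact absurd ⟨u, hu, by linarith⟩ hup'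
        · exact ⟨u, hu, h1⟩
      · have h1 := hup u hu
        have h2 := mul_le_mul_of_nonneg_left (projSum_mono hIT V u) (Nat.cast_nonneg (α := ℝ) d)
        linarith
  refine (measure_mono hsub).trans ((measure_union_le _ _).trans ?_)
  have h1 := measure_exists_projSum_gt h T U hn (by norm_num : (1 / 4 : ℝ) < 1 / 2) (by norm_num)
    (τ := 4 * m) (by positivity)
  have h2 := measure_exists_projSum_lt h I U hn hm0
  refine (add_le_add h1 h2).trans ?_
  rw [← ENNReal.ofReal_add (by positivity) (by positivity)]
  apply ENNReal.ofReal_le_ofReal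
  have e5 : ∀ j : ℕ, (5 : ℝ) ^ j ≤ Real.exp (j * (81 / 50)) := by
    intro j
    rw [Real.exp_nat_mul]
    exact pow_le_pow_left₀ (by norm_num) five_le_exp j
  have hTc : (T.card : ℝ) ≤ 2 * f := by exact_mod_cast hT
  -- The exponent is at most `(0.00162 + 0.7 - 1) * m`.
  have b1 : (5 : ℝ) ^ n * ((√(1 - 2 * (1 / 4 : ℝ)))⁻¹ ^ (l * T.card) *
      Real.exp (-(1 / 4 * (4 * m)))) ≤ Real.exp (-(l : ℝ) / 16) := by
    calc _ ≤ Real.exp (n * (81 / 50)) * (Real.exp (7 / 20) ^ (l * T.card) *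
          Real.exp (-(1 / 4 * (4 * m)))) := by
          gcongr
          · exact e5 n
          · exact inv_sqrt_half_le_exp
      _ = Real.exp (n * (81 / 50) + (((l * T.card : ℕ) : ℝ) * (7 / 20) + -(1 / 4 * (4 * m)))) := by
          rw [← Real.exp_nat_mul, ← Real.exp_add, ← Real.exp_add]
      _ ≤ _ := by
          apply Real.exp_le_exp.mpr
          push_cast
          have : (l : ℝ) * T.card ≤ 2 * m := by
            rw [hm]; nlinarith [Nat.cast_nonneg (α := ℝ) l]
          linarith
  -- The exponent is at most `(0.00972 - 1 / 2 + 3 / 8) * m`.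
  have b2 : (5 : ℝ) ^ (n * 6) * ((√3)⁻¹ ^ (l * I.card) * Real.exp (3 / 8 * m)) ≤
      Real.exp (-(l : ℝ) / 16) := by
    calc _ ≤ Real.exp ((n * 6 : ℕ) * (81 / 50)) * (Real.exp (-(1 / 2)) ^ (l * I.card) *
          Real.exp (3 / 8 * m)) := by
          gcongr
          · exact e5 _
          · exact inv_sqrt_three_le_exp
      _ = Real.exp ((n * 6 : ℕ) * (81 / 50) + (((l * I.card : ℕ) : ℝ) * (-(1 / 2)) + 3 / 8 * m)) := by
          rw [← Real.exp_nat_mul, ← Real.exp_add, ← Real.exp_add]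
      _ ≤ _ := by
          apply Real.exp_le_exp.mpr
          rw [hI]
          push_cast
          have : (l : ℝ) * f = m := by rw [hm]; ring
          rw [this]
          linarith
  linarith

/-- Here the net lives in all of `ℝ^d` and has up to `5 ^ d` points, so the Chernoff parameter must
be close to `1 / 2`; the value `7 / 16` suffices. -/
theorem measure_exists_projSum_univ_gt (h : l ≤ d) (hk : 1 ≤ k) (hd : 4 * k * l ≤ d) :
    uniformGrPi k h {V | ∃ u, 18 * ‖u‖ ^ 2 < projSum Finset.univ V u} ≤
      ENNReal.ofReal (Real.exp (-(l : ℝ) / 16)) := by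
  rcases Nat.eq_zero_or_pos d with rfl | hd0
  · have : {V : Fin k → Gr 0 l | ∃ u, 18 * ‖u‖ ^ 2 < projSum Finset.univ V u} = ∅ := by
      ext V
      simp only [Set.mem_ofPred_eq, Set.mem_empty_iff_false, iff_false, not_exists, not_lt]
      intro u
      rw [Subsingleton.elim u 0]
      simp [projSum]
    rw [this]; simp
  have hd0' : (0 : ℝ) < d := by exact_mod_cast hd0
  have hsub : {V : Fin k → Gr d l | ∃ u, 18 * ‖u‖ ^ 2 < projSum Finset.univ V u} ⊆
      {V | ∃ u ∈ (⊤ : Submodule ℝ (EuclideanSpace ℝ (Fin d))),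
        4 * (9 / 2 * d) * ‖u‖ ^ 2 < d * projSum Finset.univ V u} := by
    rintro V ⟨u, hu⟩
    refine ⟨u, trivial, ?_⟩
    nlinarith
  refine (measure_mono hsub).trans ((measure_exists_projSum_gt h Finset.univ ⊤ (n := d) (by simp)
    (by norm_num : (7 / 16 : ℝ) < 1 / 2) (by norm_num) (by positivity)).trans ?_)
  apply ENNReal.ofReal_le_ofReal
  rw [Finset.card_univ, Fintype.card_fin]
  have hd' : 4 * (k : ℝ) * l ≤ d := by exact_mod_cast hd
  have hk' : (1 : ℝ) ≤ k := by exact_mod_cast hk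
  -- With `k * l ≤ d / 4`, the exponent is at most `(1.62 + 0.26 - 63 / 32) * d < 0`.
  calc _ ≤ Real.exp (81 / 50) ^ d * (Real.exp (26 / 25) ^ (l * k) *
          Real.exp (-(7 / 16 * (9 / 2 * d)))) := by
          gcongr
          · exact five_le_exp
          · exact inv_sqrt_eighth_le_exp
      _ = Real.exp (d * (81 / 50) + (((l * k : ℕ) : ℝ) * (26 / 25) + -(7 / 16 * (9 / 2 * d)))) := by
          rw [← Real.exp_nat_mul, ← Real.exp_nat_mul, ← Real.exp_add, ← Real.exp_add]
      _ ≤ _ := by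
          apply Real.exp_le_exp.mpr
          push_cast
          have : (l : ℝ) ≤ k * l := by nlinarith [Nat.cast_nonneg (α := ℝ) l]
          nlinarith

end StageBound

/-! ### Deterministic linear algebra of the stages. -/

section Stages

variable {E : Type*} [NormedAddCommGroup E] [InnerProductSpace ℝ E]

/-- The span of the images `A b (U b)`, `b < a`, where `U b` is the set of vectors of `Y b`
orthogonal to the previous images. -/
def stageDual (Y : ℕ → Submodule ℝ E) (A : ℕ → E →ₗ[ℝ] E) : ℕ → Submodule ℝ E
  | 0 => ⊥
  | a + 1 => stageDual Y A a ⊔ (Y a ⊓ (stageDual Y A a)ᗮ).map (A a)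

/-- The vectors of `Y a` that are `A b`-orthogonal to `stageSub Y A b` for all `b < a`. -/
def stageSub (Y : ℕ → Submodule ℝ E) (A : ℕ → E →ₗ[ℝ] E) (a : ℕ) : Submodule ℝ E :=
  Y a ⊓ (stageDual Y A a)ᗮ

theorem stageDual_succ (Y : ℕ → Submodule ℝ E) (A : ℕ → E →ₗ[ℝ] E) (a : ℕ) :
    stageDual Y A (a + 1) = stageDual Y A a ⊔ (stageSub Y A a).map (A a) := rfl

theorem stageDual_congr {Y Y' : ℕ → Submodule ℝ E} {A A' : ℕ → E →ₗ[ℝ] E} {a : ℕ}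
    (hY : ∀ b < a, Y b = Y' b) (hA : ∀ b < a, A b = A' b) :
    stageDual Y A a = stageDual Y' A' a := by
  induction a with
  | zero => rfl
  | succ a ih =>
    rw [stageDual, stageDual, ih (fun b hb => hY b (by omega)) (fun b hb => hA b (by omega)),
      hY a (by omega), hA a (by omega)]

theorem stageSub_congr {Y Y' : ℕ → Submodule ℝ E} {A A' : ℕ → E →ₗ[ℝ] E} {a : ℕ}
    (hY : ∀ b ≤ a, Y b = Y' b) (hA : ∀ b < a, A b = A' b) :
    stageSub Y A a = stageSub Y' A' a := by
  rw [stageSub, stageSub, hY a le_rfl, stageDual_congr (fun b hb => hY b hb.le) hA]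

theorem mem_stageDual_succ_orthogonal {Y : ℕ → Submodule ℝ E} {A : ℕ → E →ₗ[ℝ] E} {a : ℕ} {z : E}
    (hA : (A a).IsSymmetric) :
    z ∈ (stageDual Y A (a + 1))ᗮ ↔
      z ∈ (stageDual Y A a)ᗮ ∧ ∀ w ∈ stageSub Y A a, inner ℝ (A a z) w = 0 := by
  rw [stageDual_succ, ← Submodule.inf_orthogonal, Submodule.mem_inf]
  refine and_congr_right fun _ => ?_
  rw [Submodule.mem_orthogonal]
  constructor
  · intro h w hw
    rw [hA z w, real_inner_comm]
    exact h _ (Submodule.mem_map_of_mem hw)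
  · rintro h _ ⟨w, hw, rfl⟩
    rw [real_inner_comm, ← hA z w]
    exact h w hw

variable [FiniteDimensional ℝ E]

/-- Definiteness on `U` makes the compression of `A` to `U` injective, hence surjective, so the
equations for `u` are solvable. -/
theorem exists_inner_projection (U : Submodule ℝ E) (A : E →ₗ[ℝ] E)
    (hpos : ∀ u ∈ U, inner ℝ (A u) u = 0 → u = 0) (z : E) :
    ∃ u ∈ U, ∀ w ∈ U, inner ℝ (A (z - u)) w = 0 := by
  let P : E →ₗ[ℝ] U := U.orthogonalProjectionOnto.toLinearMap
  have hP : ∀ (x : E) (w : U), inner ℝ ((P x : U) : E) (w : E) = inner ℝ x (w : E) := by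
    intro x w
    change inner ℝ (U.starProjection x) (w : E) = _
    rw [U.inner_starProjection_left_eq_right, Submodule.starProjection_mem_subspace_eq_self]
  let L : U →ₗ[ℝ] U := P ∘ₗ A ∘ₗ U.subtype
  have hinj : Function.Injective L := by
    rw [← LinearMap.ker_eq_bot, LinearMap.ker_eq_bot']
    intro u hu
    have h1 := hP (A u) u
    have h2 : P (A u) = 0 := hu
    rw [h2] at h1
    have := hpos u u.2 (by rw [← h1]; simp)
    exact Subtype.ext this
  obtain ⟨u, hu⟩ := (LinearMap.injective_iff_surjective.mp hinj) (P (A z))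
  refine ⟨u, u.2, fun w hw => ?_⟩
  have h1 := hP (A u) ⟨w, hw⟩
  have h2 := hP (A z) ⟨w, hw⟩
  have h3 : P (A u) = P (A z) := hu
  rw [h3] at h1
  rw [map_sub, inner_sub_left]
  simp only at h1 h2
  rw [← h1, ← h2, sub_self]

/-- At stage `a`, split `z = u + (z - u)` with `u` the `A a`-orthogonal projection of `z` onto the
test space. The part `u` is controlled at this stage, and `z - u` is admissible for the next one.
The factor is `4Γ + 6 = 2 * (2 + 2Γ) + 2`: the first term pays for `z - u`, the second for `u`. -/
theorem norm_sq_le_of_stages {Y : ℕ → Submodule ℝ E} (hY : Monotone Y) {A : ℕ → E →ₗ[ℝ] E}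
    (hA : ∀ a, (A a).IsSymmetric) (hA0 : ∀ a x, 0 ≤ inner ℝ (A a x) x)
    {q : ℕ → E → ℝ} (hAq : ∀ a x, inner ℝ (A a x) x ≤ q a x) (hq : ∀ a x, q (a + 1) x ≤ q a x)
    (hq2 : ∀ a x y, q a (x - y) ≤ 2 * q a x + 2 * q a y)
    {κ Γ : ℝ} (hκ : 0 < κ) (hΓ : 0 ≤ Γ) {m : ℕ}
    (hlow : ∀ a ≤ m, ∀ u ∈ stageSub Y A a, κ * ‖u‖ ^ 2 ≤ inner ℝ (A a u) u)
    (hup : ∀ a ≤ m, ∀ u ∈ stageSub Y A a, q a u ≤ Γ * inner ℝ (A a u) u)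
    {z : E} (hz : z ∈ Y m) : κ * ‖z‖ ^ 2 ≤ (4 * Γ + 6) ^ m * q 0 z := by
  have main : ∀ j a, a + j = m → ∀ z ∈ Y m, z ∈ (stageDual Y A a)ᗮ →
      κ * ‖z‖ ^ 2 ≤ (4 * Γ + 6) ^ j * q a z := by
    intro j
    induction j with
    | zero =>
      intro a ha z hz hz'
      obtain rfl : a = m := by omega
      rw [pow_zero, one_mul]
      exact (hlow a le_rfl z ⟨hz, hz'⟩).trans (hAq a z)
    | succ j ih =>
      intro a ha z hz hz'
      obtain ⟨u, hu, huw⟩ := exists_inner_projection (stageSub Y A a) (A a) (fun u hu h0 => by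
        have := hlow a (by omega) u hu
        rw [h0] at this
        have h1 : ‖u‖ ^ 2 ≤ 0 := by nlinarith [sq_nonneg ‖u‖]
        exact norm_eq_zero.mp (pow_eq_zero_iff two_ne_zero |>.mp (le_antisymm h1 (sq_nonneg _)))) z
      have hz1 : z - u ∈ Y m := Submodule.sub_mem _ hz (hY (by omega : a ≤ m) hu.1)
      have hz2 : z - u ∈ (stageDual Y A (a + 1))ᗮ :=
        (mem_stageDual_succ_orthogonal (hA a)).mpr ⟨Submodule.sub_mem _ hz' hu.2, huw⟩
      have h1 := ih (a + 1) (by omega) (z - u) hz1 hz2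
      have h2 := hq2 (a + 1) z u
      have h3 := hq a z
      have h4 := hq a u
      have h5 := hup a (by omega) u hu
      have h6 := hlow a (by omega) u hu
      -- Pythagoras for the semidefinite form of `A a`.
      have h7 : inner ℝ (A a u) u ≤ inner ℝ (A a z) z := by
        have e : inner ℝ (A a z) z = inner ℝ (A a u) u + 2 * inner ℝ (A a (z - u)) u +
            inner ℝ (A a (z - u)) (z - u) := by
          have hs := hA a z u
          simp only [map_sub, inner_sub_left, inner_sub_right]
          rw [real_inner_comm] at hs
          rw [real_inner_comm (A a z) u, real_inner_comm z (A a u)] at *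
          linarith
        rw [e, huw u hu]
        linarith [hA0 a (z - u)]
      have h8 := hAq a z
      have h9 : ‖z‖ ^ 2 ≤ 2 * ‖u‖ ^ 2 + 2 * ‖z - u‖ ^ 2 := by
        have ht : ‖z‖ ≤ ‖u‖ + ‖z - u‖ := by
          simpa using norm_add_le u (z - u)
        nlinarith [sq_nonneg (‖u‖ - ‖z - u‖), norm_nonneg z]
      have hq0 : 0 ≤ q a z := (hA0 a z).trans h8
      have h10 : q (a + 1) (z - u) ≤ (2 + 2 * Γ) * q a z := by nlinarith
      have hpow : 1 ≤ (4 * Γ + 6) ^ j := one_le_pow₀ (by linarith)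
      have h11 := mul_le_mul_of_nonneg_left h10 (by linarith : 0 ≤ (4 * Γ + 6) ^ j)
      have h12 : q a z ≤ (4 * Γ + 6) ^ j * q a z := by nlinarith
      have h13 := mul_le_mul_of_nonneg_left h9 hκ.le
      have h14 : (4 * Γ + 6) ^ (j + 1) * q a z =
          2 * ((4 * Γ + 6) ^ j * ((2 + 2 * Γ) * q a z)) + 2 * ((4 * Γ + 6) ^ j * q a z) := by ring
      linarith
  exact main m 0 (by omega) z hz (by simp [stageDual])

/-- A vector of the new test space lying already in `Y a` belongs to `stageSub Y A a` and is `A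
a`-orthogonal to it, hence to itself, so it vanishes. Only the new dimensions of `Y (a + 1)` remain.
-/
theorem finrank_stageSub_succ_le {Y : ℕ → Submodule ℝ E} {A : ℕ → E →ₗ[ℝ] E} {a f : ℕ}
    (hY : Y a ≤ Y (a + 1)) (hA : (A a).IsSymmetric)
    (hpos : ∀ u ∈ stageSub Y A a, inner ℝ (A a u) u = 0 → u = 0)
    (hf : Module.finrank ℝ (Y (a + 1)) ≤ Module.finrank ℝ (Y a) + f) :
    Module.finrank ℝ (stageSub Y A (a + 1)) ≤ f := by
  have hinf : stageSub Y A (a + 1) ⊓ Y a = ⊥ := by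
    rw [eq_bot_iff]
    rintro z ⟨⟨-, hz1⟩, hz2⟩
    obtain ⟨h1, h2⟩ := (mem_stageDual_succ_orthogonal hA).mp hz1
    exact hpos z ⟨hz2, h1⟩ (h2 z ⟨hz2, h1⟩)
  have h := Submodule.finrank_sup_add_finrank_inf_eq (stageSub Y A (a + 1)) (Y a)
  rw [hinf, finrank_bot] at h
  have h2 : Module.finrank ℝ ↥(stageSub Y A (a + 1) ⊔ Y a) ≤ Module.finrank ℝ (Y (a + 1)) :=
    Submodule.finrank_mono (sup_le inf_le_left hY)
  omega

end Stages

/-! ### Measurability of random subspaces. -/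

section MeasurableSubspace

variable {X : Type*} [MeasurableSpace X] {d : ℕ}


/-- A random subspace is measurable if its orthogonal projection is, vector by vector. -/
def MeasurableSubspace (U : X → Submodule ℝ (EuclideanSpace ℝ (Fin d))) : Prop :=
  ∀ v, Measurable fun x => (U x).starProjection v

theorem measurable_linear_apply {T : X → EuclideanSpace ℝ (Fin d) →ₗ[ℝ] EuclideanSpace ℝ (Fin d)} (hT : ∀ v, Measurable fun x => T x v)
    {w : X → EuclideanSpace ℝ (Fin d)} (hw : Measurable w) : Measurable fun x => T x (w x) := by
  have : (fun x => T x (w x)) = fun x => ∑ i, w x i • T x (EuclideanSpace.basisFun (Fin d) ℝ i) := by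
    funext x
    conv_lhs => rw [← (EuclideanSpace.basisFun (Fin d) ℝ).sum_repr (w x)]
    simp [map_sum]
  rw [this]
  refine Finset.measurable_sum _ fun i _ => ?_
  have h2 := hT (EuclideanSpace.basisFun (Fin d) ℝ i)
  have h1 : Measurable fun x => w x i := by fun_prop
  exact h1.smul h2

namespace MeasurableSubspace

variable {U W : X → Submodule ℝ (EuclideanSpace ℝ (Fin d))}

theorem apply (hU : MeasurableSubspace U) {w : X → EuclideanSpace ℝ (Fin d)} (hw : Measurable w) :
    Measurable fun x => (U x).starProjection (w x) :=
  measurable_linear_apply (T := fun x => (U x).starProjection.toLinearMap) hU hw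

theorem bot : MeasurableSubspace fun _ : X => (⊥ : Submodule ℝ (EuclideanSpace ℝ (Fin d))) := fun v => by
  simp only [Submodule.starProjection_bot]
  exact measurable_const

theorem orthogonal (hU : MeasurableSubspace U) : MeasurableSubspace fun x => (U x)ᗮ := fun v => by
  simp only [Submodule.starProjection_orthogonal_val]
  exact measurable_const.sub (hU v)

/-- One Gram–Schmidt step. The convention `x / 0 = 0` covers `v ∈ K`, so the formula is measurable
without splitting by rank. -/
theorem starProjection_sup_span_singleton (K : Submodule ℝ (EuclideanSpace ℝ (Fin d))) (v w : EuclideanSpace ℝ (Fin d)) :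
    (K ⊔ Submodule.span ℝ {v}).starProjection w = K.starProjection w +
      (inner ℝ (v - K.starProjection v) w / ‖v - K.starProjection v‖ ^ 2) •
        (v - K.starProjection v) := by
  set r := v - K.starProjection v with hr
  have hrK : ∀ y ∈ K, inner ℝ r y = 0 := fun y hy => K.starProjection_inner_eq_zero v y hy
  have hv : v = K.starProjection v + r := by rw [hr]; abel
  apply Submodule.eq_starProjection_of_mem_of_inner_eq_zero
  · refine Submodule.add_mem _ (Submodule.mem_sup_left (K.starProjection_apply_mem w))
      (Submodule.smul_mem _ _ (Submodule.sub_mem _ (Submodule.mem_sup_right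
        (Submodule.mem_span_singleton_self v)) (Submodule.mem_sup_left
          (K.starProjection_apply_mem v))))
  · have hK : ∀ y ∈ K, inner ℝ (w - (K.starProjection w + (inner ℝ r w / ‖r‖ ^ 2) • r)) y = 0 := by
      intro y hy
      rw [← sub_sub, inner_sub_left, K.starProjection_inner_eq_zero w y hy, inner_smul_left,
        hrK y hy]
      simp
    have hrr : inner ℝ (w - (K.starProjection w + (inner ℝ r w / ‖r‖ ^ 2) • r)) r = 0 := by
      have h1 : inner ℝ (K.starProjection w) r = 0 := by
        rw [real_inner_comm]; exact hrK _ (K.starProjection_apply_mem w)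
      rw [inner_sub_left, inner_add_left, h1, inner_smul_left, real_inner_self_eq_norm_sq,
        real_inner_comm]
      rcases eq_or_ne r 0 with h0 | h0
      · simp [h0]
      · have : ‖r‖ ≠ 0 := norm_ne_zero_iff.mpr h0
        simp
        field_simp
        ring
    intro y hy
    obtain ⟨a, ha, b, hb, rfl⟩ := Submodule.mem_sup.mp hy
    obtain ⟨c, rfl⟩ := Submodule.mem_span_singleton.mp hb
    rw [inner_add_right, hK a ha, inner_smul_right, hv, inner_add_right, hrr,
      hK _ (K.starProjection_apply_mem v)]
    simp

theorem sup_span_singleton (hU : MeasurableSubspace U) {v : X → EuclideanSpace ℝ (Fin d)} (hv : Measurable v) :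
    MeasurableSubspace fun x => U x ⊔ Submodule.span ℝ {v x} := fun w => by
  simp only [starProjection_sup_span_singleton]
  have h1 : Measurable fun x => v x - (U x).starProjection (v x) := hv.sub (hU.apply hv)
  have h2 := hU w
  fun_prop

theorem sup_iSup_span (hU : MeasurableSubspace U) {ι : Type*} (s : Finset ι) {v : ι → X → EuclideanSpace ℝ (Fin d)}
    (hv : ∀ i, Measurable (v i)) :
    MeasurableSubspace fun x => U x ⊔ ⨆ i ∈ s, Submodule.span ℝ {v i x} := by
  classical
  induction s using Finset.induction_on with
  | empty => simpa using hU
  | insert i s _ ih =>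
    have := ih.sup_span_singleton (hv i)
    simp only [Finset.iSup_insert]
    convert this using 2 with x
    rw [sup_assoc, sup_comm (Submodule.span ℝ {v i x})]

theorem map_eq_iSup_span (T : EuclideanSpace ℝ (Fin d) →ₗ[ℝ] EuclideanSpace ℝ (Fin d)) (K : Submodule ℝ (EuclideanSpace ℝ (Fin d))) :
    K.map T = ⨆ i ∈ (Finset.univ : Finset (Fin d)),
      Submodule.span ℝ {T (K.starProjection (EuclideanSpace.basisFun (Fin d) ℝ i))} := by
  simp only [Finset.mem_univ, iSup_pos]
  apply le_antisymm
  · rintro _ ⟨y, hy, rfl⟩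
    have h1 : K.starProjection y = y := Submodule.starProjection_eq_self_iff.mpr hy
    rw [← h1, ← (EuclideanSpace.basisFun (Fin d) ℝ).sum_repr y, map_sum, map_sum]
    refine Submodule.sum_mem _ fun i _ => ?_
    rw [map_smul, map_smul]
    exact Submodule.smul_mem _ _ (Submodule.mem_iSup_of_mem i (Submodule.mem_span_singleton_self _))
  · refine iSup_le fun i => ?_
    rw [Submodule.span_singleton_le_iff_mem]
    exact Submodule.mem_map_of_mem (K.starProjection_apply_mem _)

theorem sup_map (hU : MeasurableSubspace U) (hW : MeasurableSubspace W) {T : X → EuclideanSpace ℝ (Fin d) →ₗ[ℝ] EuclideanSpace ℝ (Fin d)}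
    (hT : ∀ v, Measurable fun x => T x v) :
    MeasurableSubspace fun x => U x ⊔ (W x).map (T x) := by
  simp only [map_eq_iSup_span]
  exact hU.sup_iSup_span _ fun i => measurable_linear_apply hT (hW _)

theorem sup (hU : MeasurableSubspace U) (hW : MeasurableSubspace W) :
    MeasurableSubspace fun x => U x ⊔ W x := by
  simpa using hU.sup_map hW (T := fun _ => LinearMap.id) fun _ => measurable_const

theorem inf (hU : MeasurableSubspace U) (hW : MeasurableSubspace W) :
    MeasurableSubspace fun x => U x ⊓ W x := by
  have := (hU.orthogonal.sup hW.orthogonal).orthogonal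
  simpa [← Submodule.inf_orthogonal] using this

theorem span_finset {ι : Type*} (s : Finset ι) {v : ι → X → EuclideanSpace ℝ (Fin d)} (hv : ∀ i, Measurable (v i)) :
    MeasurableSubspace fun x => ⨆ i ∈ s, Submodule.span ℝ {v i x} := by
  simpa using (bot (X := X) (d := d)).sup_iSup_span s hv

theorem stageDual {Y : X → ℕ → Submodule ℝ (EuclideanSpace ℝ (Fin d))} {A : X → ℕ → EuclideanSpace ℝ (Fin d) →ₗ[ℝ] EuclideanSpace ℝ (Fin d)}
    (hY : ∀ a, MeasurableSubspace fun x => Y x a) (hA : ∀ a v, Measurable fun x => A x a v) (a : ℕ) :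
    MeasurableSubspace fun x => _root_.stageDual (Y x) (A x) a := by
  induction a with
  | zero => exact bot
  | succ a ih => exact ih.sup_map ((hY a).inf ih.orthogonal) (hA a)

theorem stageSub {Y : X → ℕ → Submodule ℝ (EuclideanSpace ℝ (Fin d))} {A : X → ℕ → EuclideanSpace ℝ (Fin d) →ₗ[ℝ] EuclideanSpace ℝ (Fin d)}
    (hY : ∀ a, MeasurableSubspace fun x => Y x a) (hA : ∀ a v, Measurable fun x => A x a v) (a : ℕ) :
    MeasurableSubspace fun x => _root_.stageSub (Y x) (A x) a :=
  (hY a).inf (stageDual hY hA a).orthogonal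

/-- An event of the form "some vector of the random subspace satisfies a strict inequality between
continuous functions" is measurable. -/
theorem measurableSet_exists_lt (hU : MeasurableSubspace U) {F G : X → EuclideanSpace ℝ (Fin d) → ℝ}
    (hF : ∀ x, Continuous (F x)) (hG : ∀ x, Continuous (G x))
    (hFm : ∀ w : X → EuclideanSpace ℝ (Fin d), Measurable w → Measurable fun x => F x (w x))
    (hGm : ∀ w : X → EuclideanSpace ℝ (Fin d), Measurable w → Measurable fun x => G x (w x)) :
    MeasurableSet {x | ∃ u ∈ U x, F x u < G x u} := by
  -- The strict inequality is an open condition, so it can be tested on the projections of a dense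
  -- sequence.
  have : {x | ∃ u ∈ U x, F x u < G x u} =
      ⋃ n, {x | F x ((U x).starProjection (TopologicalSpace.denseSeq (EuclideanSpace ℝ (Fin d)) n)) <
        G x ((U x).starProjection (TopologicalSpace.denseSeq (EuclideanSpace ℝ (Fin d)) n))} := by
    ext x
    simp only [Set.mem_ofPred_eq, Set.mem_iUnion]
    constructor
    · rintro ⟨u, hu, hlt⟩
      have hopen : IsOpen {v | F x ((U x).starProjection v) < G x ((U x).starProjection v)} :=
        isOpen_lt ((hF x).comp (U x).starProjection.continuous)
          ((hG x).comp (U x).starProjection.continuous)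
      have hne : {v | F x ((U x).starProjection v) < G x ((U x).starProjection v)}.Nonempty :=
        ⟨u, by
          rw [Set.mem_ofPred_eq, Submodule.starProjection_eq_self_iff.mpr hu]; exact hlt⟩
      obtain ⟨v, hv, n, rfl⟩ := (TopologicalSpace.denseRange_denseSeq (EuclideanSpace ℝ (Fin d))).inter_open_nonempty _ hopen hne
      exact ⟨n, hv⟩
    · rintro ⟨n, hn⟩
      exact ⟨_, (U x).starProjection_apply_mem _, hn⟩
  rw [this]
  exact MeasurableSet.iUnion fun n => measurableSet_lt (hFm _ (hU _)) (hGm _ (hU _))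

end MeasurableSubspace

theorem measurable_projSum_comp {k l : ℕ} (I : Finset (Fin k)) {V : X → Fin k → Gr d l}
    (hV : Measurable V) {w : X → EuclideanSpace ℝ (Fin d)} (hw : Measurable w) :
    Measurable fun x => projSum I (V x) (w x) := by
  unfold projSum
  refine Finset.measurable_sum _ fun i _ => ?_
  have h : ∀ v, Measurable fun x => (V x i).proj v := fun v =>
    (Gr.measurable_proj_apply v).comp ((measurable_pi_apply i).comp hV)
  exact (measurable_linear_apply (T := fun x => (V x i).proj.toLinearMap) h hw).norm.pow_const 2

theorem measurableSet_distorts {k l f : ℕ} (I T : Finset (Fin k)) {V : X → Fin k → Gr d l}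
    (hV : Measurable V) {U : X → Submodule ℝ (EuclideanSpace ℝ (Fin d))} (hU : MeasurableSubspace U) :
    MeasurableSet {x | Distorts f I T (V x) (U x)} := by
  have h1 := hU.measurableSet_exists_lt (F := fun _ u => 16 * (f * l : ℝ) * ‖u‖ ^ 2)
    (G := fun x u => d * projSum T (V x) u) (fun _ => by fun_prop)
    (fun x => continuous_const.mul (continuous_projSum T (V x))) (fun w hw => by fun_prop)
    (fun w hw => (measurable_projSum_comp T hV hw).const_mul _)
  have h2 := hU.measurableSet_exists_lt (G := fun _ u => 4 / 25 * (f * l : ℝ) * ‖u‖ ^ 2)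
    (F := fun x u => d * projSum I (V x) u)
    (fun x => continuous_const.mul (continuous_projSum I (V x))) (fun _ => by fun_prop)
    (fun w hw => (measurable_projSum_comp I hV hw).const_mul _) (fun w hw => by fun_prop)
  convert h1.union h2 using 1
  ext x
  simp only [Distorts, Set.mem_ofPred_eq, Set.mem_union, ← exists_or, ← and_or_left]

end MeasurableSubspace

/-! ### Redrawing the responses of the later rounds. -/

section Resampling

variable {Ω Y : Type*} [MeasurableSpace Ω] [MeasurableSpace Y]

/-- Mixing two independent samples coordinate by coordinate gives a sample again. This replaces
conditioning on the coordinates satisfying `p`. -/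
theorem measurePreserving_ite_pi {ι : Type*} [Fintype ι] (μ : ι → Measure Y)
    [∀ i, IsProbabilityMeasure (μ i)] (p : ι → Prop) [DecidablePred p] :
    MeasurePreserving (fun x : (ι → Y) × (ι → Y) => fun i => if p i then x.1 i else x.2 i)
      ((Measure.pi μ).prod (Measure.pi μ)) (Measure.pi μ) := by
  have hm : Measurable (fun x : (ι → Y) × (ι → Y) => fun i => if p i then x.1 i else x.2 i) := by
    refine measurable_pi_lambda _ fun i => ?_
    split_ifs
    · exact (measurable_pi_apply i).comp measurable_fst
    · exact (measurable_pi_apply i).comp measurable_snd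
  refine ⟨hm, ?_⟩
  symm
  apply Measure.pi_eq
  intro s hs
  rw [Measure.map_apply hm (MeasurableSet.univ_pi hs)]
  have : (fun x : (ι → Y) × (ι → Y) => fun i => if p i then x.1 i else x.2 i) ⁻¹' Set.univ.pi s =
      (Set.univ.pi fun i => if p i then s i else Set.univ) ×ˢ
        (Set.univ.pi fun i => if p i then Set.univ else s i) := by
    ext x
    simp only [Set.mem_preimage, Set.mem_pi, Set.mem_univ, true_imp_iff, Set.mem_prod,
      ← forall_and]
    refine forall_congr' fun i => ?_
    split_ifs <;> simp
  rw [this, Measure.prod_prod, Measure.pi_pi, Measure.pi_pi, ← Finset.prod_mul_distrib]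
  refine Finset.prod_congr rfl fun i _ => ?_
  split_ifs <;> simp

/-- Bounding the probability of an event conditionally on the seed and on the coordinates
satisfying `p`. -/
theorem measure_prod_pi_le_of_sections (P : Measure Ω) [IsProbabilityMeasure P] {ι : Type*}
    [Fintype ι] (μ : ι → Measure Y) [∀ i, IsProbabilityMeasure (μ i)] (p : ι → Prop)
    [DecidablePred p] {S : Set (Ω × (ι → Y))} (hS : MeasurableSet S) {ε : ENNReal}
    (h : ∀ (ω : Ω) (W : ι → Y), Measure.pi μ {V | (ω, fun i => if p i then W i else V i) ∈ S} ≤ ε) :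
    (P.prod (Measure.pi μ)) S ≤ ε := by
  have hmp := (MeasurePreserving.id P).prod (measurePreserving_ite_pi μ p)
  rw [← hmp.measure_preimage hS.nullMeasurableSet, Measure.prod_apply (hmp.measurable hS)]
  calc _ ≤ ∫⁻ _, ε ∂P := by
        refine lintegral_mono fun ω => ?_
        rw [Measure.prod_apply (measurable_prodMk_left (hmp.measurable hS))]
        calc _ ≤ ∫⁻ _, ε ∂Measure.pi μ := lintegral_mono fun W => h ω W
          _ = ε := by simp
    _ = ε := by simp

end Resampling

/-! ### Blocks of rounds and the spans of the queries. -/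

section Rounds

variable {d l k : ℕ}

/-- The rounds `a ≤ i < b`. -/
def rows (k a b : ℕ) : Finset (Fin k) := Finset.univ.filter fun i => a ≤ i.val ∧ i.val < b

theorem mem_rows {a b : ℕ} {i : Fin k} : i ∈ rows k a b ↔ a ≤ i.val ∧ i.val < b := by
  simp [rows]

theorem card_rows_le (a b : ℕ) : (rows k a b).card ≤ b - a := by
  rw [← Nat.card_Ico, ← Finset.card_map Fin.valEmbedding]
  refine Finset.card_le_card fun i hi => ?_
  obtain ⟨j, hj, rfl⟩ := Finset.mem_map.mp hi
  exact Finset.mem_Ico.mpr (mem_rows.mp hj)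

theorem card_rows {a b : ℕ} (hb : b ≤ k) : (rows k a b).card = b - a := by
  rw [← Nat.card_Ico, ← Finset.card_map Fin.valEmbedding]
  congr 1
  ext i
  rw [Finset.mem_map, Finset.mem_Ico]
  constructor
  · rintro ⟨j, hj, rfl⟩
    exact mem_rows.mp hj
  · intro hi
    exact ⟨⟨i, by omega⟩, mem_rows.mpr hi, rfl⟩

theorem rows_mono {a b a' b' : ℕ} (ha : a' ≤ a) (hb : b ≤ b') : rows k a b ⊆ rows k a' b' := by
  intro i hi
  rw [mem_rows] at hi ⊢
  omega

/-- The sum of the projections of the rounds in `I`. -/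
def projOp (I : Finset (Fin k)) (V : Fin k → Gr d l) :
    EuclideanSpace ℝ (Fin d) →ₗ[ℝ] EuclideanSpace ℝ (Fin d) :=
  ∑ i ∈ I, (V i).proj.toLinearMap

theorem projOp_apply (I : Finset (Fin k)) (V : Fin k → Gr d l) (x) :
    projOp I V x = ∑ i ∈ I, (V i).proj x := by
  simp [projOp]

theorem projOp_isSymmetric (I : Finset (Fin k)) (V : Fin k → Gr d l) :
    (projOp I V).IsSymmetric := by
  intro x y
  rw [projOp_apply, projOp_apply, sum_inner, inner_sum]
  exact Finset.sum_congr rfl fun i _ => (V i).1.inner_starProjection_left_eq_right x y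

theorem inner_projOp_self (I : Finset (Fin k)) (V : Fin k → Gr d l) (x) :
    inner ℝ (projOp I V x) x = projSum I V x := by
  rw [projOp_apply, sum_inner, projSum]
  refine Finset.sum_congr rfl fun i _ => ?_
  exact (V i).1.re_inner_starProjection_eq_normSq x

theorem projOp_congr {I : Finset (Fin k)} {V V' : Fin k → Gr d l} (h : ∀ i ∈ I, V i = V' i) :
    projOp I V = projOp I V' :=
  Finset.sum_congr rfl fun i hi => by rw [h i hi]

theorem projSum_congr {I : Finset (Fin k)} {V V' : Fin k → Gr d l} (h : ∀ i ∈ I, V i = V' i) (x) :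
    projSum I V x = projSum I V' x :=
  Finset.sum_congr rfl fun i hi => by rw [h i hi]

theorem distorts_congr {f : ℕ} {I T : Finset (Fin k)} (hIT : I ⊆ T) {V V' : Fin k → Gr d l}
    (h : ∀ i ∈ T, V i = V' i) (U : Submodule ℝ (EuclideanSpace ℝ (Fin d))) :
    Distorts f I T V U ↔ Distorts f I T V' U := by
  simp only [Distorts, projSum_congr h, projSum_congr fun i hi => h i (hIT hi)]

theorem finrank_iSup_span_le {ι E : Type*} [AddCommGroup E] [Module ℝ E]
    [FiniteDimensional ℝ E] (s : Finset ι) (v : ι → E) :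
    Module.finrank ℝ ↥(⨆ i ∈ s, Submodule.span ℝ {v i}) ≤ s.card := by
  classical
  rw [← Submodule.span_iUnion₂]
  have : (⋃ i ∈ s, {v i}) = ((s.image v : Finset E) : Set E) := by
    ext x; simp [eq_comm]
  rw [this]
  exact (finrank_span_finset_le_card _).trans Finset.card_image_le

variable {Ω : Type*} [MeasurableSpace Ω]

/-- The span of the queries of the rounds `j ≤ t`. -/
def querySpan (A : ProbingPlayer Ω d l k) (ω : Ω) (V : Fin k → Gr d l) (t : ℕ) :
    Submodule ℝ (EuclideanSpace ℝ (Fin d)) :=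
  ⨆ j ∈ rows k 0 (t + 1), Submodule.span ℝ {A.y ω V j}

/-- Query `t` is included although response `t` is not used: it is submitted before `V_t` is
revealed. -/
theorem querySpan_congr (A : ProbingPlayer Ω d l k) (ω : Ω) {V V' : Fin k → Gr d l} {t : ℕ}
    (h : ∀ i : Fin k, i.val < t → V i = V' i) : querySpan A ω V t = querySpan A ω V' t := by
  refine iSup_congr fun j => iSup_congr fun hj => ?_
  have : A.y ω V j = A.y ω V' j := by
    unfold ProbingPlayer.y
    congr 2
    funext i
    have hi : i.1.val < j.val := i.2
    have := (mem_rows.mp hj).2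
    exact h i.1 (by omega)
  rw [this]

theorem querySpan_mono (A : ProbingPlayer Ω d l k) (ω : Ω) (V : Fin k → Gr d l) :
    Monotone (querySpan A ω V) := fun _ _ h =>
  biSup_mono fun _ hj => rows_mono le_rfl (by omega) hj

theorem finrank_querySpan_le (A : ProbingPlayer Ω d l k) (ω : Ω) (V : Fin k → Gr d l) (t : ℕ) :
    Module.finrank ℝ (querySpan A ω V t) ≤ t + 1 :=
  (finrank_iSup_span_le _ _).trans ((card_rows_le _ _).trans (by omega))

theorem finrank_querySpan_le_add (A : ProbingPlayer Ω d l k) (ω : Ω) (V : Fin k → Gr d l)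
    (t t' : ℕ) :
    Module.finrank ℝ (querySpan A ω V t') ≤ Module.finrank ℝ (querySpan A ω V t) + (t' - t) := by
  have hle : querySpan A ω V t' ≤ querySpan A ω V t ⊔
      ⨆ j ∈ rows k (t + 1) (t' + 1), Submodule.span ℝ {A.y ω V j} := by
    refine iSup₂_le fun j hj => ?_
    rw [mem_rows] at hj
    rcases le_or_gt j.val t with h | h
    · exact le_sup_of_le_left (le_biSup (fun j => Submodule.span ℝ {A.y ω V j})
        (mem_rows.mpr ⟨by omega, by omega⟩))
    · exact le_sup_of_le_right (le_biSup (fun j => Submodule.span ℝ {A.y ω V j})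
        (mem_rows.mpr ⟨by omega, by omega⟩))
  have h1 := Submodule.finrank_mono hle
  have h2 := Submodule.finrank_add_le_finrank_add_finrank (querySpan A ω V t)
    (⨆ j ∈ rows k (t + 1) (t' + 1), Submodule.span ℝ {A.y ω V j})
  have h3 := finrank_iSup_span_le (rows k (t + 1) (t' + 1)) (A.y ω V)
  have h4 := card_rows_le (k := k) (t + 1) (t' + 1)
  omega

theorem measurable_y (A : ProbingPlayer Ω d l k) (j : Fin k) :
    Measurable fun x : Ω × (Fin k → Gr d l) => A.y x.1 x.2 j := by
  refine (A.measurable_query j).comp (measurable_fst.prodMk ?_)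
  exact measurable_pi_lambda _ fun i => (measurable_pi_apply _).comp measurable_snd

theorem measurableSubspace_querySpan (A : ProbingPlayer Ω d l k) (t : ℕ) :
    MeasurableSubspace fun x : Ω × (Fin k → Gr d l) => querySpan A x.1 x.2 t :=
  MeasurableSubspace.span_finset _ (measurable_y A)

theorem measurable_projOp (I : Finset (Fin k)) (v : EuclideanSpace ℝ (Fin d)) :
    Measurable fun x : Ω × (Fin k → Gr d l) => projOp I x.2 v := by
  simp only [projOp_apply]
  exact Finset.measurable_sum _ fun i _ =>
    (Gr.measurable_proj_apply v).comp ((measurable_pi_apply i).comp measurable_snd)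

end Rounds

/-! ### Geometric stage lengths. -/

section StageTimes

/-- The number of rounds of the last `m` stages. -/
def geomSum (p m : ℕ) : ℕ := ∑ b ∈ Finset.range m, p ^ b

theorem geomSum_succ (p m : ℕ) : geomSum p (m + 1) = geomSum p m + p ^ m :=
  Finset.sum_range_succ _ _

theorem geomSum_mono (p : ℕ) : Monotone (geomSum p) :=
  monotone_nat_of_le_succ fun m => by rw [geomSum_succ]; omega

theorem geomSum_succ_le {p : ℕ} (hp : 2 ≤ p) (m : ℕ) : geomSum p (m + 1) ≤ 2 * p ^ m := by
  induction m with
  | zero => simp [geomSum]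
  | succ m ih =>
    rw [geomSum_succ, pow_succ]
    nlinarith [Nat.zero_le (p ^ m)]

/-- The first round of stage `a`, when `n` rounds end with `s` stages of lengths
`p ^ (s - 1), …, p, 1`. -/
def stageTime (p s n a : ℕ) : ℕ := n - geomSum p (s - a)

theorem stageTime_mono (p s n : ℕ) : Monotone (stageTime p s n) := fun a b h => by
  have := geomSum_mono p (show s - b ≤ s - a by omega)
  unfold stageTime
  omega

theorem stageTime_le (p s n a : ℕ) : stageTime p s n a ≤ n := Nat.sub_le _ _

theorem stageTime_succ {p s n a : ℕ} (hn : geomSum p s ≤ n) (ha : a < s) :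
    stageTime p s n (a + 1) = stageTime p s n a + p ^ (s - 1 - a) := by
  have h1 := geomSum_mono p (show s - a ≤ s by omega)
  have h2 := geomSum_succ p (s - 1 - a)
  rw [show s - 1 - a + 1 = s - a by omega] at h2
  unfold stageTime
  rw [show s - (a + 1) = s - 1 - a by omega]
  omega

end StageTimes

/-! ### The stages of the game and their failure probability. -/

section Rounds

variable {Ω : Type*} [MeasurableSpace Ω] {d l k : ℕ}

/-- The subspace on which the responses of stage `a` are tested: it depends on the responses of
the previous stages only. -/
def testSpace (A : ProbingPlayer Ω d l k) (p s n a : ℕ) (x : Ω × (Fin k → Gr d l)) :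
    Submodule ℝ (EuclideanSpace ℝ (Fin d)) :=
  stageSub (fun b => querySpan A x.1 x.2 (stageTime p s n b))
    (fun b => projOp (rows k (stageTime p s n b) (stageTime p s n (b + 1))) x.2) a

/-- The responses from stage `a` on distort the test space of stage `a`. -/
def StageFails (A : ProbingPlayer Ω d l k) (p s n a : ℕ) (x : Ω × (Fin k → Gr d l)) : Prop :=
  Distorts (p ^ (s - 1 - a)) (rows k (stageTime p s n a) (stageTime p s n (a + 1)))
    (rows k (stageTime p s n a) n) x.2 (testSpace A p s n a x)

theorem measurableSubspace_testSpace (A : ProbingPlayer Ω d l k) (p s n a : ℕ) :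
    MeasurableSubspace (testSpace A p s n a) :=
  MeasurableSubspace.stageSub (fun _ => measurableSubspace_querySpan A _)
    (fun _ => measurable_projOp _) a

theorem measurableSet_stageFails (A : ProbingPlayer Ω d l k) (p s n a : ℕ) :
    MeasurableSet {x | StageFails A p s n a x} :=
  measurableSet_distorts _ _ measurable_snd (measurableSubspace_testSpace A p s n a)

theorem testSpace_congr (A : ProbingPlayer Ω d l k) {p s n a : ℕ} {ω : Ω}
    {V V' : Fin k → Gr d l} (h : ∀ i : Fin k, i.val < stageTime p s n a → V i = V' i) :
    testSpace A p s n a (ω, V) = testSpace A p s n a (ω, V') := by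
  apply stageSub_congr
  · intro b hb
    exact querySpan_congr A ω fun i hi => h i (hi.trans_le (stageTime_mono p s n hb))
  · intro b hb
    refine projOp_congr fun i hi => h i ?_
    exact (mem_rows.mp hi).2.trans_le (stageTime_mono p s n (by omega))

theorem le_projSum_of_not_stageFails {A : ProbingPlayer Ω d l k} {p s n a : ℕ}
    {x : Ω × (Fin k → Gr d l)} (h : ¬StageFails A p s n a x) {u : EuclideanSpace ℝ (Fin d)}
    (hu : u ∈ testSpace A p s n a x) :
    4 / 25 * ((p ^ (s - 1 - a) : ℕ) * l : ℝ) * ‖u‖ ^ 2 ≤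
      d * projSum (rows k (stageTime p s n a) (stageTime p s n (a + 1))) x.2 u := by
  by_contra! hcon
  exact h ⟨u, hu, Or.inr hcon⟩

theorem projSum_le_of_not_stageFails {A : ProbingPlayer Ω d l k} {p s n a : ℕ}
    {x : Ω × (Fin k → Gr d l)} (h : ¬StageFails A p s n a x) {u : EuclideanSpace ℝ (Fin d)}
    (hu : u ∈ testSpace A p s n a x) :
    d * projSum (rows k (stageTime p s n a) n) x.2 u ≤
      16 * ((p ^ (s - 1 - a) : ℕ) * l : ℝ) * ‖u‖ ^ 2 := by
  by_contra! hcon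
  exact h ⟨u, hu, Or.inl hcon⟩

/-- A later test space only sees the queries added during the preceding stage, which is `p` times
longer; this needs the preceding stage not to fail. The first test space contains at most `n -
geomSum p s + 1 ≤ p ^ s` dimensions, by maximality of `s`. -/
theorem finrank_testSpace_le {A : ProbingPlayer Ω d l k} {p s n a : ℕ} (hp : 2 ≤ p) (hl : 1 ≤ l)
    (hn : geomSum p s ≤ n) (hn' : n < geomSum p (s + 1)) (ha : a < s)
    {x : Ω × (Fin k → Gr d l)} (h : ∀ b < a, ¬StageFails A p s n b x) :
    Module.finrank ℝ (testSpace A p s n a x) ≤ p * p ^ (s - 1 - a) := by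
  cases a with
  | zero =>
    have h1 : Module.finrank ℝ (testSpace A p s n 0 x) ≤
        Module.finrank ℝ (querySpan A x.1 x.2 (stageTime p s n 0)) :=
      Submodule.finrank_mono inf_le_left
    have h2 := finrank_querySpan_le A x.1 x.2 (stageTime p s n 0)
    rw [← pow_succ', show s - 1 - 0 + 1 = s by omega]
    rw [geomSum_succ] at hn'
    unfold stageTime at *
    rw [Nat.sub_zero] at *
    omega
  | succ a =>
    refine finrank_stageSub_succ_le (querySpan_mono A x.1 x.2 (stageTime_mono p s n (by omega)))
      (projOp_isSymmetric _ _) ?_ ?_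
    · intro u hu h0
      rw [inner_projOp_self] at h0
      have h1 := le_projSum_of_not_stageFails (h a (by omega)) hu
      rw [h0, mul_zero] at h1
      have h2 : (0 : ℝ) < (p ^ (s - 1 - a) : ℕ) * l := by
        have : 0 < p ^ (s - 1 - a) * l := by positivity
        exact_mod_cast this
      have h3 : ‖u‖ ^ 2 ≤ 0 := by nlinarith [sq_nonneg ‖u‖]
      exact norm_eq_zero.mp (pow_eq_zero_iff two_ne_zero |>.mp (le_antisymm h3 (sq_nonneg _)))
    · refine (finrank_querySpan_le_add A x.1 x.2 (stageTime p s n a) _).trans ?_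
      rw [stageTime_succ hn (by omega), ← pow_succ', show s - 1 - (a + 1) + 1 = s - 1 - a by omega]
      simp

/-- With the seed and the responses before stage `a` frozen, the test space is fixed while the
remaining responses are still uniform and independent. Success of the earlier stages supplies its
dimension bound. -/
theorem measure_stageFails_le (A : ProbingPlayer Ω d l k) (P : Measure Ω) [IsProbabilityMeasure P]
    (h : l ≤ d) {p s n a : ℕ} (hp : 2 ≤ p) (hl : 1 ≤ l) (hpl : 1000 * p ≤ l) (hnk : n ≤ k)
    (hn : geomSum p s ≤ n) (hn' : n < geomSum p (s + 1)) (ha : a < s) :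
    (P.prod (uniformGrPi k h)) {x | StageFails A p s n a x ∧ ∀ b < a, ¬StageFails A p s n b x} ≤
      ENNReal.ofReal (2 * Real.exp (-(l : ℝ) / 16)) := by
  have hmeas : MeasurableSet {x | StageFails A p s n a x ∧ ∀ b < a, ¬StageFails A p s n b x} := by
    have h1 : {x | ∀ b < a, ¬StageFails A p s n b x} =
        ⋂ b, ⋂ _ : b < a, {x | StageFails A p s n b x}ᶜ := by ext; simp
    have h2 : MeasurableSet {x | ∀ b < a, ¬StageFails A p s n b x} := by
      rw [h1]
      exact MeasurableSet.iInter fun b => MeasurableSet.iInter fun _ =>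
        (measurableSet_stageFails A p s n b).compl
    exact (measurableSet_stageFails A p s n a).inter h2
  refine measure_prod_pi_le_of_sections P (fun _ : Fin k => uniformGr h)
    (fun i => i.val < stageTime p s n a) hmeas fun ω W => ?_
  set U := testSpace A p s n a (ω, W) with hU
  have hUV : ∀ V : Fin k → Gr d l, testSpace A p s n a
      (ω, fun i => if i.val < stageTime p s n a then W i else V i) = U := fun V =>
    testSpace_congr A fun i hi => if_pos hi
  set S := {V : Fin k → Gr d l | (ω, fun i => if i.val < stageTime p s n a then W i else V i) ∈
    {x | StageFails A p s n a x ∧ ∀ b < a, ¬StageFails A p s n b x}} with hS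
  -- The dimension bound is available only if the earlier stages succeed for the frozen data, which
  -- any point of the section witnesses.
  rcases S.eq_empty_or_nonempty with hemp | ⟨V₀, hV₀⟩
  · rw [hemp]; simp
  have hrank : Module.finrank ℝ U ≤ p * p ^ (s - 1 - a) := by
    rw [← hUV V₀]
    exact finrank_testSpace_le hp hl hn hn' ha hV₀.2
  have hIT : rows k (stageTime p s n a) (stageTime p s n (a + 1)) ⊆
      rows k (stageTime p s n a) n := rows_mono le_rfl (stageTime_le p s n (a + 1))
  have hsub : S ⊆ {V | Distorts (p ^ (s - 1 - a))
      (rows k (stageTime p s n a) (stageTime p s n (a + 1))) (rows k (stageTime p s n a) n) V U} := by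
    intro V hV
    have h1 : StageFails A p s n a (ω, fun i => if i.val < stageTime p s n a then W i else V i) :=
      hV.1
    unfold StageFails at h1
    rw [hUV V] at h1
    refine (distorts_congr hIT (fun i hi => ?_) U).mp h1
    exact if_neg (by have := (mem_rows.mp hi).1; omega)
  refine (measure_mono hsub).trans (measure_distorts_le h hIT ?_ ?_ ?_ U hrank ?_)
  · exact Nat.one_le_pow _ _ (by omega)
  · rw [card_rows ((stageTime_le p s n (a + 1)).trans hnk), stageTime_succ hn ha]
    omega
  · refine (card_rows_le _ _).trans ?_
    have h1 := geomSum_succ_le hp (s - 1 - a)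
    rw [show s - 1 - a + 1 = s - a by omega] at h1
    unfold stageTime
    omega
  · calc 1000 * (p * p ^ (s - 1 - a)) = p ^ (s - 1 - a) * (1000 * p) := by ring
      _ ≤ _ := Nat.mul_le_mul_left _ hpl

theorem measure_exists_stageFails_le (A : ProbingPlayer Ω d l k) (P : Measure Ω)
    [IsProbabilityMeasure P] (h : l ≤ d) {p s n : ℕ} (hp : 2 ≤ p) (hl : 1 ≤ l)
    (hpl : 1000 * p ≤ l) (hnk : n ≤ k) (hn : geomSum p s ≤ n) (hn' : n < geomSum p (s + 1)) :
    (P.prod (uniformGrPi k h)) {x | ∃ a < s, StageFails A p s n a x} ≤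
      ENNReal.ofReal (s * (2 * Real.exp (-(l : ℝ) / 16))) := by
  have hsub : {x | ∃ a < s, StageFails A p s n a x} ⊆
      {x | ∃ a ∈ Finset.range s, x ∈
        {x | StageFails A p s n a x ∧ ∀ b < a, ¬StageFails A p s n b x}} := by
    classical
    rintro x ⟨a, ha, hx⟩
    have hex : ∃ a, StageFails A p s n a x := ⟨a, hx⟩
    -- Select the first failing stage.
    exact ⟨Nat.find hex, Finset.mem_range.mpr ((Nat.find_min' hex hx).trans_lt ha),
      Nat.find_spec hex, fun b hb => Nat.find_min hex hb⟩
  refine (measure_mono hsub).trans (measure_finset_exists_le _ _ _ (Finset.card_range s).le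
    fun a ha => ?_)
  exact measure_stageFails_le A P h hp hl hpl hnk hn hn' (Finset.mem_range.mp ha)

theorem le_projSum_of_forall_not_stageFails {A : ProbingPlayer Ω d l k} {p s n : ℕ} (hp : 2 ≤ p)
    (hl : 1 ≤ l) (hd : 1 ≤ d) (hs : 1 ≤ s) {x : Ω × (Fin k → Gr d l)}
    (h : ∀ a < s, ¬StageFails A p s n a x) {z : EuclideanSpace ℝ (Fin d)}
    (hz : z ∈ querySpan A x.1 x.2 (n - 1)) :
    4 / 25 * (l / d : ℝ) * ‖z‖ ^ 2 ≤ 406 ^ (s - 1) * projSum (rows k 0 n) x.2 z := by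
  have hd0 : (0 : ℝ) < d := by exact_mod_cast hd
  have hl0 : (0 : ℝ) < l := by exact_mod_cast hl
  -- The last stage has length one, so its query span already contains all queries of the first `n`
  -- rounds.
  have htime : stageTime p s n (s - 1) = n - 1 := by
    unfold stageTime
    rw [show s - (s - 1) = 1 by omega]
    simp [geomSum]
  have key := norm_sq_le_of_stages (Y := fun b => querySpan A x.1 x.2 (stageTime p s n b))
    (fun b c hbc => querySpan_mono A x.1 x.2 (stageTime_mono p s n hbc))
    (A := fun b => projOp (rows k (stageTime p s n b) (stageTime p s n (b + 1))) x.2)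
    (fun _ => projOp_isSymmetric _ _)
    (fun _ _ => by rw [inner_projOp_self]; exact projSum_nonneg _ _ _)
    (q := fun a => projSum (rows k (stageTime p s n a) n) x.2)
    (fun a y => by
      rw [inner_projOp_self]
      exact projSum_mono (rows_mono le_rfl (stageTime_le p s n (a + 1))) _ _)
    (fun a y => projSum_mono (rows_mono (stageTime_mono p s n (Nat.le_succ a)) le_rfl) _ _)
    (fun a y w => by
      have h1 := projSum_add_le (rows k (stageTime p s n a) n) x.2 y ((-1 : ℝ) • w)
      rw [projSum_smul] at h1
      rw [sub_eq_add_neg, ← neg_one_smul ℝ w]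
      linarith)
    -- `Γ` is the ratio of the two distortion constants, `16 / (4 / 25) = 100`, whence `4Γ + 6 =
    -- 406`; `κ` is the lower constant for the shortest stage.
    (κ := 4 / 25 * (l / d : ℝ)) (Γ := 100) (m := s - 1) (by positivity) (by norm_num)
    (fun a ha u hu => by
      rw [inner_projOp_self]
      have h1 := le_projSum_of_not_stageFails (h a (by omega)) hu
      have h2 : (1 : ℝ) ≤ (p ^ (s - 1 - a) : ℕ) := by
        exact_mod_cast Nat.one_le_pow _ _ (by omega)
      have h3 : (l : ℝ) ≤ (p ^ (s - 1 - a) : ℕ) * l := by nlinarith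
      have h4 : 4 / 25 * (l / d : ℝ) * ‖u‖ ^ 2 = (4 / 25 * l * ‖u‖ ^ 2) / d := by ring
      rw [h4, div_le_iff₀' hd0]
      refine le_trans ?_ h1
      gcongr)
    (fun a ha u hu => by
      rw [inner_projOp_self]
      have h1 := le_projSum_of_not_stageFails (h a (by omega)) hu
      have h2 := projSum_le_of_not_stageFails (h a (by omega)) hu
      refine le_of_mul_le_mul_left ?_ hd0
      linarith)
    (z := z) (by rw [htime]; exact hz)
  refine key.trans ?_
  norm_num
  exact projSum_mono (rows_mono (Nat.zero_le _) le_rfl) _ _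

end Rounds

/-! ### From the stage estimates to the winning probability. -/

section Final

variable {Ω : Type*} [MeasurableSpace Ω] {d l k : ℕ}

theorem exists_geomSum_le_lt (p : ℕ) (hp : 2 ≤ p) {n : ℕ} (hn : 1 ≤ n) :
    ∃ s, 1 ≤ s ∧ geomSum p s ≤ n ∧ n < geomSum p (s + 1) := by
  have hlb : ∀ m, m ≤ geomSum p m := by
    intro m
    induction m with
    | zero => exact Nat.zero_le _
    | succ m ih =>
      rw [geomSum_succ]
      have := Nat.one_le_pow m p (by omega)
      omega
  have hex : ∃ m, n < geomSum p (m + 1) := ⟨n, hlb (n + 1)⟩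
  have h1 : geomSum p 1 = 1 := by simp [geomSum]
  have hpos : 1 ≤ Nat.find hex := by
    by_contra! h0
    have := Nat.find_spec hex
    rw [show Nat.find hex = 0 by omega, h1] at this
    omega
  refine ⟨Nat.find hex, hpos, ?_, Nat.find_spec hex⟩
  have := Nat.find_min hex (m := Nat.find hex - 1) (by omega)
  rw [show Nat.find hex - 1 + 1 = Nat.find hex by omega] at this
  omega

theorem projSum_starProjection_iSup (V : Fin k → Gr d l) (i : Fin k) (z) :
    projSum (rows k 0 (i + 1)) V z =
      projSum (rows k 0 (i + 1)) V ((⨆ j : {j : Fin k // j ≤ i}, (V j.1).1).starProjection z) := by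
  refine Finset.sum_congr rfl fun j hj => ?_
  have hji : j ≤ i := by
    have := (mem_rows.mp hj).2
    exact Fin.le_def.mpr (by omega)
  have hle : (V j).1 ≤ ⨆ j : {j : Fin k // j ≤ i}, (V j.1).1 :=
    le_iSup (fun j : {j : Fin k // j ≤ i} => (V j.1).1) ⟨j, hji⟩
  have h := congrArg (fun T => T z) (Submodule.starProjection_comp_starProjection_of_le hle)
  change ‖(V j).1.starProjection z‖ ^ 2 = ‖(V j).1.starProjection _‖ ^ 2
  rw [← h]
  rfl

theorem span_queries_le (A : ProbingPlayer Ω d l k) (ω : Ω) (V : Fin k → Gr d l) (i : Fin k) :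
    Submodule.span ℝ {v | ∃ j ≤ i, v = A.y ω V j} ≤ querySpan A ω V i := by
  rw [Submodule.span_le]
  rintro _ ⟨j, hj, rfl⟩
  have h : Submodule.span ℝ {A.y ω V j} ≤ querySpan A ω V i :=
    le_biSup (fun j => Submodule.span ℝ {A.y ω V j})
      (mem_rows.mpr ⟨Nat.zero_le _, Nat.lt_succ_of_le (Fin.le_def.mp hj)⟩)
  exact h (Submodule.mem_span_singleton_self _)

theorem sq_le_of_le_sqrt {α ρ : ℝ} (hρ0 : 0 ≤ ρ)
    (hρ : ρ ≤ 1 / 12 * Real.sqrt (l / (d * (k : ℝ) ^ α))) :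
    ρ ^ 2 ≤ 1 / 144 * (l / (d * (k : ℝ) ^ α)) := by
  have h0 : (0 : ℝ) ≤ l / (d * (k : ℝ) ^ α) := by positivity
  calc ρ ^ 2 ≤ (1 / 12 * Real.sqrt (l / (d * (k : ℝ) ^ α))) ^ 2 := by gcongr
    _ = _ := by rw [mul_pow, Real.sq_sqrt h0]; norm_num

/-- The only query is independent of `V_1`, so one lower-tail bound with threshold `l / 100 > l /
144` suffices, without a net. -/
theorem winProb_lt_of_one_round (A : ProbingPlayer Ω d l 1) (P : Measure Ω)
    [IsProbabilityMeasure P] (h : l ≤ d) (hl : 1 ≤ l) {ρ : ℝ}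
    (hρ : 0 ≤ ρ → ρ ^ 2 ≤ 1 / 144 * (l / d : ℝ)) :
    A.winProb P h ρ < 4 * d * Real.exp (-(l : ℝ) / 16) := by
  have hd1 : (1 : ℝ) ≤ d := by exact_mod_cast hl.trans h
  have hl0 : (0 : ℝ) < l := by exact_mod_cast hl
  set S : Set (Ω × (Fin 1 → Gr d l)) := {x | d * projSum Finset.univ x.2 (A.y x.1 x.2 0) <
    1 / 100 * l * ‖A.y x.1 x.2 0‖ ^ 2} with hS
  have hSm : MeasurableSet S := measurableSet_lt
    ((measurable_projSum_comp Finset.univ measurable_snd (measurable_y A 0)).const_mul _)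
    (((measurable_y A 0).norm.pow_const 2).const_mul _)
  have hSp : (P.prod (uniformGrPi 1 h)) S ≤
      ENNReal.ofReal ((√(1 - 2 * (-1 : ℝ)))⁻¹ ^ (l * (Finset.univ : Finset (Fin 1)).card) *
        Real.exp (-(-1 * (1 / 100 * l)))) := by
    refine measure_prod_pi_le_of_sections P (fun _ : Fin 1 => uniformGr h) (fun _ => False) hSm
      fun ω W => ?_
    refine (measure_mono fun V hV => ?_).trans (measure_projSum_tail_le h Finset.univ
      (by norm_num : (-1 : ℝ) < 1 / 2) (1 / 100 * l) (A.y ω W 0))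
    have hy : A.y ω V 0 = A.y ω W 0 := by
      unfold ProbingPlayer.y
      congr 2
      funext i
      exact absurd i.2 (Fin.not_lt_zero _)
    have hV' : d * projSum Finset.univ V (A.y ω V 0) < 1 / 100 * l * ‖A.y ω V 0‖ ^ 2 := by
      simpa [hS] using hV
    rw [hy] at hV'
    rw [Set.mem_ofPred_eq]
    linarith
  have hwin : {x : Ω × (Fin 1 → Gr d l) | A.Wins ρ x.1 x.2} ⊆ S := by
    rintro x ⟨i, z, hz, hzρ, hz1⟩
    obtain rfl : i = 0 := Subsingleton.elim _ _
    have hz' : z ∈ Submodule.span ℝ {A.y x.1 x.2 0} := by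
      refine (Submodule.span_mono ?_) hz
      rintro _ ⟨j, -, rfl⟩
      rw [Subsingleton.elim j 0]
      rfl
    obtain ⟨c, rfl⟩ := Submodule.mem_span_singleton.mp hz'
    have hρ0 : 0 ≤ ρ := (norm_nonneg _).trans hzρ
    have h1 := projSum_starProjection_iSup x.2 0 (c • A.y x.1 x.2 0)
    set w := (⨆ j : {j : Fin 1 // j ≤ 0}, (x.2 j.1).1).starProjection (c • A.y x.1 x.2 0) with hw
    have hrows : rows 1 0 ((0 : Fin 1) + 1) = Finset.univ := by
      ext j
      simpa [mem_rows] using Subsingleton.elim j 0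
    rw [hrows] at h1
    have h2 : projSum Finset.univ x.2 w ≤ ‖w‖ ^ 2 := by
      simp only [projSum, Finset.univ_unique, Finset.sum_singleton]
      have := (x.2 default).1.norm_starProjection_apply_le w
      exact pow_le_pow_left₀ (norm_nonneg _) this 2
    have h3 : ‖w‖ ^ 2 ≤ ρ ^ 2 := pow_le_pow_left₀ (norm_nonneg _) hzρ 2
    have h4 := hρ hρ0
    rw [← h1, projSum_smul] at h2
    rw [norm_smul] at hz1
    have hc : c ^ 2 * ‖A.y x.1 x.2 0‖ ^ 2 = 1 := by
      rw [← sq_abs c, ← Real.norm_eq_abs, ← mul_pow, hz1, one_pow]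
    have h5 : c ^ 2 * projSum Finset.univ x.2 (A.y x.1 x.2 0) ≤ 1 / 144 * (l / d : ℝ) := by linarith
    have h6 : d * (c ^ 2 * projSum Finset.univ x.2 (A.y x.1 x.2 0)) ≤ 1 / 144 * l := by
      calc _ ≤ d * (1 / 144 * (l / d : ℝ)) := by gcongr
        _ = _ := by field_simp
    have h7 : c ^ 2 * (d * projSum Finset.univ x.2 (A.y x.1 x.2 0)) <
        c ^ 2 * (1 / 100 * l * ‖A.y x.1 x.2 0‖ ^ 2) := by
      have : c ^ 2 * (1 / 100 * l * ‖A.y x.1 x.2 0‖ ^ 2) = 1 / 100 * l := by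
        linear_combination (1 / 100 * (l : ℝ)) * hc
      rw [this]
      linarith
    exact lt_of_mul_lt_mul_left h7 (sq_nonneg c)
  have hle : A.winProb P h ρ ≤ (√(1 - 2 * (-1 : ℝ)))⁻¹ ^ (l * (Finset.univ : Finset (Fin 1)).card) *
      Real.exp (-(-1 * (1 / 100 * l))) :=
    ENNReal.toReal_le_of_le_ofReal (by positivity) ((measure_mono hwin).trans hSp)
  refine hle.trans_lt ?_
  rw [Finset.card_univ, Fintype.card_fin, mul_one, show (1 : ℝ) - 2 * (-1) = 3 by norm_num]
  calc _ ≤ Real.exp (-(1 / 2)) ^ l * Real.exp (-(-1 * (1 / 100 * l))) := by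
        gcongr
        exact inv_sqrt_three_le_exp
    _ = Real.exp (l * (-(1 / 2)) + -(-1 * (1 / 100 * l))) := by
        rw [← Real.exp_nat_mul, ← Real.exp_add]
    _ ≤ Real.exp (-(l : ℝ) / 16) := Real.exp_le_exp.mpr (by linarith)
    _ < 4 * d * Real.exp (-(l : ℝ) / 16) := by
        have := Real.exp_pos (-(l : ℝ) / 16)
        nlinarith

theorem winProb_lt_of_large (A : ProbingPlayer Ω d l k) (P : Measure Ω)
    [IsProbabilityMeasure P] (h : l ≤ d) (hl : 1 ≤ l) (hk : 1 ≤ k) (hd : 4 * k * l ≤ d) {p : ℕ}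
    (hp : 2 ≤ p) (hpl : 1000 * p ≤ l) {α : ℝ} (hα : 0 < α) (hpα : 406 ≤ (p : ℝ) ^ α)
    (hkl : Real.log k ≤ l) {ρ : ℝ} (hρ : ρ ≤ 1 / 12 * Real.sqrt (l / (d * (k : ℝ) ^ α))) :
    A.winProb P h ρ < 4 * d * Real.exp (-(l : ℝ) / 16) := by
  have hd1 : 1 ≤ d := hl.trans h
  have hd0 : (0 : ℝ) < d := by exact_mod_cast hd1
  have hl0 : (0 : ℝ) < l := by exact_mod_cast hl
  have hk0 : (1 : ℝ) ≤ k := by exact_mod_cast hk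
  choose s hs using fun i : Fin k => exists_geomSum_le_lt p hp (Nat.le_add_left 1 i.val)
  have hpow : ∀ i, p ^ (s i - 1) ≤ k := by
    intro i
    have h1 := geomSum_succ p (s i - 1)
    rw [show s i - 1 + 1 = s i by have := (hs i).1; omega] at h1
    have := (hs i).2.1
    omega
  -- The number of stages is logarithmic in `k`, and `log k ≤ l`, so the union bound costs at most
  -- of order `k * l ≤ d / 4`.
  have hsl : ∀ i, (s i : ℝ) ≤ 3 * l := by
    intro i
    have h1 : ((2 : ℝ) ^ (s i - 1)) ≤ k := by
      exact_mod_cast (Nat.pow_le_pow_left hp _).trans (hpow i)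
    have h2 := Real.log_le_log (by positivity) h1
    rw [Real.log_pow] at h2
    have h3 := Real.log_two_gt_d9
    have h4 : (s i : ℝ) ≤ (s i - 1 : ℕ) + 1 := by
      have : s i ≤ s i - 1 + 1 := by omega
      exact_mod_cast this
    have h5 : (1 : ℝ) ≤ l := by exact_mod_cast hl
    nlinarith [Nat.cast_nonneg (α := ℝ) (s i - 1)]
  set e := Real.exp (-(l : ℝ) / 16) with he
  have he0 : 0 < e := Real.exp_pos _
  have hfails : (P.prod (uniformGrPi k h)) {x | ∃ i ∈ (Finset.univ : Finset (Fin k)), x ∈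
      {x | ∃ a < s i, StageFails A p (s i) (i + 1) a x}} ≤ ENNReal.ofReal (k * (6 * l * e)) := by
    refine measure_finset_exists_le _ _ _ (by simp) fun i _ => ?_
    refine (measure_exists_stageFails_le A P h hp hl hpl i.2 (hs i).2.1 (hs i).2.2).trans ?_
    apply ENNReal.ofReal_le_ofReal
    have := hsl i
    nlinarith
  have hbig : (P.prod (uniformGrPi k h)) (Prod.snd ⁻¹'
      {V | ∃ u, 18 * ‖u‖ ^ 2 < projSum Finset.univ V u}) ≤ ENNReal.ofReal e := by
    have : Prod.snd ⁻¹' {V : Fin k → Gr d l | ∃ u, 18 * ‖u‖ ^ 2 < projSum Finset.univ V u} =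
        (Set.univ : Set Ω) ×ˢ {V | ∃ u, 18 * ‖u‖ ^ 2 < projSum Finset.univ V u} := by
      ext; simp
    rw [this, Measure.prod_prod, measure_univ, one_mul]
    exact measure_exists_projSum_univ_gt h hk hd
  have hwin : {x : Ω × (Fin k → Gr d l) | A.Wins ρ x.1 x.2} ⊆
      {x | ∃ i ∈ (Finset.univ : Finset (Fin k)), x ∈
        {x | ∃ a < s i, StageFails A p (s i) (i + 1) a x}} ∪
      Prod.snd ⁻¹' {V | ∃ u, 18 * ‖u‖ ^ 2 < projSum Finset.univ V u} := by
    rintro x ⟨i, z, hz, hzρ, hz1⟩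
    by_contra hcon
    simp only [Set.mem_union, Set.mem_ofPred_eq, Finset.mem_univ, true_and, Set.mem_preimage,
      not_or, not_exists, not_and, not_lt] at hcon
    obtain ⟨hc1, hc2⟩ := hcon
    have h1 := le_projSum_of_forall_not_stageFails hp hl hd1 (hs i).1 (hc1 i)
      (span_queries_le A x.1 x.2 i hz)
    rw [hz1, projSum_starProjection_iSup] at h1
    set w := (⨆ j : {j : Fin k // j ≤ i}, (x.2 j.1).1).starProjection z
    have hρ0 : 0 ≤ ρ := (norm_nonneg _).trans hzρ
    have h2 : projSum (rows k 0 (i + 1)) x.2 w ≤ 18 * (1 / 144 * (l / (d * (k : ℝ) ^ α))) := by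
      calc _ ≤ projSum Finset.univ x.2 w := projSum_mono (Finset.subset_univ _) _ _
        _ ≤ 18 * ‖w‖ ^ 2 := hc2 w
        _ ≤ 18 * ρ ^ 2 := by gcongr
        _ ≤ _ := by gcongr; exact sq_le_of_le_sqrt hρ0 hρ
    have h3 : (406 : ℝ) ^ (s i - 1) ≤ (k : ℝ) ^ α := by
      calc (406 : ℝ) ^ (s i - 1) ≤ ((p : ℝ) ^ α) ^ (s i - 1) := by gcongr
        _ = ((p ^ (s i - 1) : ℕ) : ℝ) ^ α := by
            rw [← Real.rpow_natCast, ← Real.rpow_mul (by positivity), mul_comm α,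
              Real.rpow_mul (by positivity), Real.rpow_natCast]
            push_cast
            rfl
        _ ≤ _ := by
            apply Real.rpow_le_rpow (by positivity) _ hα.le
            exact_mod_cast hpow i
    have hkα : 0 < (k : ℝ) ^ α := by positivity
    have h4 : (406 : ℝ) ^ (s i - 1) * projSum (rows k 0 (i + 1)) x.2 w ≤ 1 / 8 * (l / d : ℝ) := by
      calc _ ≤ (k : ℝ) ^ α * (18 * (1 / 144 * (l / (d * (k : ℝ) ^ α)))) := by
            gcongr
            exact projSum_nonneg _ _ _
        _ = _ := by field_simp; norm_num
    -- The contradiction is `4 / 25 > 18 / 144 = 1 / 8`.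
    have h5 : (0 : ℝ) < l / d := by positivity
    linarith
  have hle : A.winProb P h ρ ≤ k * (6 * l * e) + e := by
    refine ENNReal.toReal_le_of_le_ofReal (by positivity) ?_
    rw [ENNReal.ofReal_add (by positivity) he0.le]
    exact (measure_mono hwin).trans ((measure_union_le _ _).trans (add_le_add hfails hbig))
  refine hle.trans_lt ?_
  have hd' : 4 * (k : ℝ) * l ≤ d := by exact_mod_cast hd
  have hkl1 : (1 : ℝ) ≤ k * l := by
    have : 1 ≤ k * l := Nat.mul_pos hk hl
    exact_mod_cast this
  -- The total is `(6kl + 1) * e ≤ 7kl * e`, against `4d * e ≥ 16kl * e`.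
  nlinarith

end Final

/-! ### Choice of the constant and conclusion. -/

/-- Here `1624000 = 4000 * 406`. The outer exponent `1 / log 2` cancels the `log 2` in the exponent
of `probingConst`, and `1 / α ≥ 1` allows `4000` to be absorbed. -/
theorem le_probingConst {α : ℝ} (hα : 0 < α) (hα1 : α ≤ 1) :
    4000 * (406 : ℝ) ^ (1 / α) ≤ probingConst ((1624000 : ℝ) ^ (1 / Real.log 2)) α := by
  have hlog : 0 < Real.log 2 := Real.log_pos (by norm_num)
  have h1 : 1 ≤ 1 / α := by rw [le_div_iff₀ hα]; linarith
  unfold probingConst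
  calc 4000 * (406 : ℝ) ^ (1 / α) ≤ (4000 : ℝ) ^ (1 / α) * (406 : ℝ) ^ (1 / α) := by
        gcongr
        exact Real.self_le_rpow_of_one_le (by norm_num) h1
    _ = (1624000 : ℝ) ^ (1 / α) := by
        rw [← Real.mul_rpow (by norm_num) (by norm_num)]; norm_num
    _ = ((1624000 : ℝ) ^ (1 / Real.log 2)) ^ (Real.log 2 / α) := by
        rw [← Real.rpow_mul (by norm_num)]
        congr 1
        field_simp
    _ ≤ _ := by
        apply Real.rpow_le_rpow (by positivity) _ (by positivity)
        exact le_div_self (by positivity) hα hα1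

end

theorem mainTheorem5 :
    ∃ C₂ : ℝ, 8 ≤ C₂ ∧
      ∀ α : ℝ, 0 < α → α ≤ 1 →
      ∀ (d l k : ℕ) (_hk : 1 ≤ k) (_hl : 1 ≤ l) (hld : l ≤ d) (ρ : ℝ),
        4 * k * l ≤ d →
        probingConst C₂ α * Real.log k ≤ l →
        ρ ≤ 1 / 12 * Real.sqrt (l / (d * (k : ℝ) ^ α)) →
        ∀ (Ω : Type*) [MeasurableSpace Ω] (P : Measure Ω) [IsProbabilityMeasure P]
          (A : ProbingPlayer Ω d l k),
          A.winProb P hld ρ < 4 * d * Real.exp (-(l : ℝ) / 16) := by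
  have hlog := Real.log_two_gt_d9
  have hlog' := Real.log_two_lt_d9
  refine ⟨(1624000 : ℝ) ^ (1 / Real.log 2), ?_, ?_⟩
  · calc (8 : ℝ) ≤ 1624000 := by norm_num
      _ ≤ _ := Real.self_le_rpow_of_one_le (by norm_num)
          (by rw [le_div_iff₀ (by linarith)]; linarith)
  intro α hα hα1 d l k hk hl hld ρ hd hkl hρ Ω _ P _ A
  rcases hk.eq_or_lt with rfl | hk2
  · refine winProb_lt_of_one_round A P hld hl fun hρ0 => ?_
    have := sq_le_of_le_sqrt hρ0 hρ
    simpa using this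
  -- The stage ratio is `p = ⌈c⌉₊`, essentially the least with `p ^ α ≥ 406`. Since `log k ≥ log 2`,
  -- the bound `4000 * c * log k ≤ l` leaves room for `1000 * p ≤ 1000 * (c + 1)`.
  set c : ℝ := (406 : ℝ) ^ (1 / α) with hc
  have hc1 : 406 ≤ c := Real.self_le_rpow_of_one_le (by norm_num)
    (by rw [le_div_iff₀ hα]; linarith)
  have hconst := le_probingConst hα hα1
  rw [← hc] at hconst
  have hk2' : (2 : ℝ) ≤ k := by exact_mod_cast hk2
  have hlk : Real.log 2 ≤ Real.log k := Real.log_le_log (by norm_num) hk2'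
  have hl1 : 4000 * c * Real.log k ≤ l :=
    (mul_le_mul_of_nonneg_right hconst (by linarith)).trans hkl
  have hpc : (⌈c⌉₊ : ℝ) < c + 1 := Nat.ceil_lt_add_one (by linarith)
  have hcp : c ≤ ⌈c⌉₊ := Nat.le_ceil c
  refine winProb_lt_of_large A P hld hl hk hd (p := ⌈c⌉₊) ?_ ?_ hα ?_ ?_ hρ
  · have : (2 : ℝ) ≤ ⌈c⌉₊ := by linarith
    exact_mod_cast this
  · have : (1000 : ℝ) * ⌈c⌉₊ ≤ l := by nlinarith
    exact_mod_cast this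
  · calc (406 : ℝ) = c ^ α := by
          rw [hc, ← Real.rpow_mul (by norm_num), one_div_mul_cancel hα.ne', Real.rpow_one]
      _ ≤ _ := Real.rpow_le_rpow (by linarith) hcp hα.le
  · nlinarith
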